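/- A line network of length $H$ has nodes $0,1,\dots,H$, source $0$, destination $H$ and a finite set $E$ of links; each link lies on one hop $h\in\{1,\dots,H\}$, that is, it goes from node $h-1$ to node $h$ (parallel links are allowed, and each hop has at least one link). $\mathcal P$ is the set of loop-free paths from source to destination, each path being identified with its set of links. Each link $i$ has a parameter $\theta_i\in(0,1]$, and its delay is geometric on $\{1,2,\dots\}$ with parameter $\theta_i$, independently over links. Put $D_\theta(p)=\sum_{i\in p}1/\theta_i$ and $\mu_\theta(p)=1/D_\theta(p)$, and let $\psi^p_\theta$ be the law of the total delay along $p$. Assume that the path $p^\star$ that minimizes $D_\theta$ over $\mathcal P$ is unique; equivalently, each hop has a unique best link (largest parameter). Let $\zeta(i)$ be the best link on the hop of $i$, and for $i\ne\zeta(i)$ let $p^i=(p^\star\setminus\{\zeta(i)\})\cup\{i\}$. All Kullback-Leibler divergences $\mathrm{KL}(P\,\|\,Q)=\sum_k P(k)\log\frac{P(k)}{Q(k)}$ take values in $[0,\infty]$, with the conventions $a/\infty=0$ and $0\cdot\infty=0$, and an infimum over the empty set is $+\infty$; $\mathrm{KLG}(u,v)$ and $\mathrm{KL}(u,v)$ denote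 the divergence between two geometric, respectively two Bernoulli, laws with parameters $u$ and $v$. Define $$B_1(\theta)=\{\lambda\in(0,1]^E:\ \{\lambda_i\}_{i\in p^\star}=\{\theta_i\}_{i\in p^\star}\text{ as multisets},\ \min_{p\in\mathcal P}D_\lambda(p)<D_\lambda(p^\star)\},$$ $$B_2(\theta)=\{\lambda\in(0,1]^E:\ \lambda_i=\theta_i\ \forall i\in p^\star,\ \min_{p\in\mathcal P}D_\lambda(p)<D_\lambda(p^\star)\}.$$ Let $$C_1(\theta)=\inf\Big\{\sum_{p\in\mathcal P}x_p\,(D_\theta(p)-D_\theta(p^\star)):\ x\ge0,\ \inf_{\lambda\in B_1(\theta)}\sum_{p\ne p^\star}x_p\,\mathrm{KL}(\psi_\theta^p\,\|\,\psi_\lambda^p)\ge1\Big\},$$ $$C_2(\theta)=\inf\Big\{\sum_{p\in\mathcal P}x_p\,(D_\theta(p)-D_\theta(p^\star)):\ x\ge0,\ \inf_{\lambda\in B_2(\theta)}\sum_{p\ne p^\star}x_p\sum_{i\in p}\mathrm{KLG}(\theta_i,\lambda_i)\ge1\Big\},$$ $$C_3(\theta)=\frac1{\mu_\theta(p^\star)}\inf\Big\{\sum_{p\in\mathcal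 P}x_p\,(\mu_\theta(p^\star)-\mu_\theta(p)):\ x\ge0,\ \inf_{\lambda\in B_2(\theta)}\sum_{p\ne p^\star}x_p\sum_{i\in p}\frac{1/\theta_i}{D_\theta(p)}\,\mathrm{KL}(\theta_i,\lambda_i)\ge1\Big\}.$$ Then $$\text{(i)}\quad C_2(\theta)=C_3(\theta)=\sum_{i:\,i\neq\zeta(i)}\frac{\frac1{\theta_i}-\frac1{\theta_{\zeta(i)}}}{\mathrm{KLG}(\theta_i,\theta_{\zeta(i)})},$$ and, if $\theta_{\zeta(i)}<1$ for every link $i\ne\zeta(i)$, $$\text{(ii)}\quad C_1(\theta)=\sum_{i:\,i\neq\zeta(i)}\frac{\frac1{\theta_i}-\frac1{\theta_{\zeta(i)}}}{\sum_{k\ge H}\psi_\theta^{p^i}(k)\log\frac{\psi_\theta^{p^i}(k)}{\psi_\theta^{p^\star}(k)}}.$$ -/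

import Mathlib

open scoped ENNReal NNReal

noncomputable section

/-- A directed multigraph with node set `V` and link set `E`, together with a source and a
destination node. -/
structure RoutingNetwork (V E : Type*) where
  /-- the node at which a link starts -/
  tail : E → V
  /-- the node at which a link ends -/
  head : E → V
  /-- the source node -/
  source : V
  /-- the destination node -/
  dest : V

/-- Kullback-Leibler divergence `∑ a, f a * log (f a / g a)` of two probability mass functions on
a countable set, with values in `[0, ∞]`. It is `∞` if `f` is not absolutely continuous with respect
to `g`, or if the series does not converge absolutely (its negative part always converges, so its
sum is then `+∞`). Terms with `f a = 0` vanish. -/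
def klMass {α : Type*} (f g : α → ℝ) : ℝ≥0∞ :=
  open Classical in
  if (∀ a, g a = 0 → f a = 0) ∧ Summable (fun a => f a * Real.log (f a / g a)) then
    ENNReal.ofReal (∑' a, f a * Real.log (f a / g a))
  else ∞

/-- Probability that a geometric random variable on `{1, 2, …}` with success probability `u` is
equal to `k`. -/
def geoMass (u : ℝ) (k : ℕ) : ℝ := if k = 0 then 0 else u * (1 - u) ^ (k - 1)

/-- Mass function of a Bernoulli random variable with mean `u`. -/
def berMass (u : ℝ) (b : Bool) : ℝ := if b then u else 1 - u

/-- `KLG(u, v)`: the divergence between the geometric laws with parameters `u` and `v`. -/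
def KLG (u v : ℝ) : ℝ≥0∞ := klMass (geoMass u) (geoMass v)

/-- The divergence between the Bernoulli laws with means `u` and `v`. -/
def KLBer (u v : ℝ) : ℝ≥0∞ := klMass (berMass u) (berMass v)

/-- `ψ_θ^p(k)`: the probability that the sum of independent geometric delays, one for each link
`i` of `p` with parameter `θ i`, is equal to `k` (sum over all the ways to split `k` into per-link
delays `d i`, `i ∈ p`). -/
def pathDelayMass {E : Type*} [DecidableEq E] (θ : E → ℝ) (p : Finset E) (k : ℕ) : ℝ :=
  ∑ d ∈ Finset.piAntidiag p k, ∏ i ∈ p, geoMass (θ i) (d i)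

/-- `D_θ(p)`: the average delay of a path. -/
def avgDelay {E : Type*} (θ : E → ℝ) (p : Finset E) : ℝ := ∑ i ∈ p, 1 / θ i

/-- `μ_θ(p) = 1 / D_θ(p)`: the average throughput of a path. -/
def throughput {E : Type*} (θ : E → ℝ) (p : Finset E) : ℝ := 1 / avgDelay θ p

/-- The link parameters are success probabilities in `(0, 1]`. -/
def IsLinkParam {E : Type*} (θ : E → ℝ) : Prop := ∀ i, 0 < θ i ∧ θ i ≤ 1

/-- Information number with bandit feedback: divergence of the end-to-end delay laws on `p`. -/
def infoBandit {E : Type*} [DecidableEq E] (θ lam : E → ℝ) (p : Finset E) : ℝ≥0∞ :=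
  klMass (pathDelayMass θ p) (pathDelayMass lam p)

/-- Information number with semi-bandit feedback: `∑ i ∈ p, KLG(θ_i, λ_i)`. -/
def infoSemiBandit {E : Type*} (θ lam : E → ℝ) (p : Finset E) : ℝ≥0∞ :=
  ∑ i ∈ p, KLG (θ i) (lam i)

/-- Information number per time slot for hop-by-hop routing along `p`: the location of the packet
is a Markov chain whose stationary probability of being at the tail of link `i ∈ p` is
`(1 / θ_i) / ∑ j ∈ p, 1 / θ_j`, and there the packet moves on with probability `θ_i` and stays with
probability `1 - θ_i`. -/
def infoHopByHop {E : Type*} (θ lam : E → ℝ) (p : Finset E) : ℝ≥0∞ :=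
  ∑ i ∈ p, ENNReal.ofReal ((1 / θ i) / ∑ j ∈ p, 1 / θ j) * KLBer (θ i) (lam i)

namespace RoutingNetwork

/-- `G.IsWalk v l w`: the links in `l` are consecutive and lead from node `v` to node `w`. -/
def IsWalk {V E : Type*} (G : RoutingNetwork V E) : V → List E → V → Prop
  | v, [], w => v = w
  | v, e :: l, w => G.tail e = v ∧ G.IsWalk (G.head e) l w

/-- `p` is the set of links of a loop-free path from the source to the destination: a walk that
visits no node twice. -/
def IsPath {V E : Type*} [DecidableEq E] (G : RoutingNetwork V E) (p : Finset E) : Prop :=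
  ∃ l : List E, G.IsWalk G.source l G.dest ∧ (G.source :: l.map G.head).Nodup ∧ l.toFinset = p

/-- The finite set `𝒫` of loop-free paths from the source to the destination. -/
def paths {V E : Type*} [Fintype E] [DecidableEq E] (G : RoutingNetwork V E) :
    Finset (Finset E) :=
  open Classical in Finset.univ.filter G.IsPath

/-- `p` is the (unique) path with minimum average delay under `θ`. -/
def IsOptimalPath {V E : Type*} [Fintype E] [DecidableEq E] (G : RoutingNetwork V E)
    (θ : E → ℝ) (p : Finset E) : Prop :=
  p ∈ G.paths ∧ ∀ q ∈ G.paths, q ≠ p → avgDelay θ p < avgDelay θ q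

/-- `B₁(θ)`: the parameters `λ` under which `pstar` is not optimal although the parameters on
`pstar` are the same as under `θ` up to order, so that the end-to-end delay law on `pstar` does not
distinguish them. -/
def badBandit {V E : Type*} [Fintype E] [DecidableEq E] (G : RoutingNetwork V E)
    (θ : E → ℝ) (pstar : Finset E) : Set (E → ℝ) :=
  {lam | IsLinkParam lam ∧ pstar.val.map lam = pstar.val.map θ ∧
    ∃ p ∈ G.paths, avgDelay lam p < avgDelay lam pstar}

/-- `B₂(θ)`: the parameters `λ` that agree with `θ` on the links of `pstar` and under which `pstar`
is not optimal. -/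
def badSemiBandit {V E : Type*} [Fintype E] [DecidableEq E] (G : RoutingNetwork V E)
    (θ : E → ℝ) (pstar : Finset E) : Set (E → ℝ) :=
  {lam | IsLinkParam lam ∧ (∀ i ∈ pstar, lam i = θ i) ∧
    ∃ p ∈ G.paths, avgDelay lam p < avgDelay lam pstar}

/-- The infimum of `∑ p ∈ 𝒫, x_p * cost p` over all `x ≥ 0` with
`inf_{λ ∈ B} ∑ p ≠ pstar, x_p * info λ p ≥ 1`. -/
def lowerBoundProgram {V E : Type*} [Fintype E] [DecidableEq E] (G : RoutingNetwork V E)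
    (pstar : Finset E) (cost : Finset E → ℝ) (B : Set (E → ℝ))
    (info : (E → ℝ) → Finset E → ℝ≥0∞) : ℝ≥0∞ :=
  ⨅ (x : Finset E → ℝ≥0)
    (_ : 1 ≤ ⨅ lam ∈ B, ∑ p ∈ G.paths.erase pstar, (x p : ℝ≥0∞) * info lam p),
    ∑ p ∈ G.paths, (x p : ℝ≥0∞) * ENNReal.ofReal (cost p)

/-- `C₁(θ)`: regret constant for source routing with bandit feedback. -/
def C1 {V E : Type*} [Fintype E] [DecidableEq E] (G : RoutingNetwork V E)
    (θ : E → ℝ) (pstar : Finset E) : ℝ≥0∞ :=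
  G.lowerBoundProgram pstar (fun p => avgDelay θ p - avgDelay θ pstar)
    (G.badBandit θ pstar) (infoBandit θ)

/-- `C₂(θ)`: regret constant for source routing with semi-bandit feedback. -/
def C2 {V E : Type*} [Fintype E] [DecidableEq E] (G : RoutingNetwork V E)
    (θ : E → ℝ) (pstar : Finset E) : ℝ≥0∞ :=
  G.lowerBoundProgram pstar (fun p => avgDelay θ p - avgDelay θ pstar)
    (G.badSemiBandit θ pstar) (infoSemiBandit θ)

/-- Throughput regret constant for hop-by-hop routing: the cost of a path is its loss of
throughput. -/
def C3Throughput {V E : Type*} [Fintype E] [DecidableEq E] (G : RoutingNetwork V E)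
    (θ : E → ℝ) (pstar : Finset E) : ℝ≥0∞ :=
  G.lowerBoundProgram pstar (fun p => throughput θ pstar - throughput θ p)
    (G.badSemiBandit θ pstar) (infoHopByHop θ)

/-- `C₃(θ)`: delay regret constant for hop-by-hop routing, which is the throughput regret constant
divided by the optimal throughput. -/
def C3 {V E : Type*} [Fintype E] [DecidableEq E] (G : RoutingNetwork V E)
    (θ : E → ℝ) (pstar : Finset E) : ℝ≥0∞ :=
  G.C3Throughput θ pstar / ENNReal.ofReal (throughput θ pstar)

end RoutingNetwork

/-- The line network of length `H`: the nodes are `0, …, H`, the source is `0`, the destination is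
`H`, and each link `e` on hop `hop e = h` leads from node `h` to node `h + 1`. -/
def lineNetwork {E : Type*} {H : ℕ} (hop : E → Fin H) : RoutingNetwork (Fin (H + 1)) E where
  tail e := (hop e).castSucc
  head e := (hop e).succ
  source := 0
  dest := Fin.last H

/-- `j` is a best link (largest success probability) on the hop of link `i`. -/
def IsBestLinkOnHop {E : Type*} {H : ℕ} (hop : E → Fin H) (θ : E → ℝ) (i j : E) : Prop :=
  hop j = hop i ∧ ∀ k, hop k = hop i → θ k ≤ θ j

end

/-!
Two facts carry the computation of the three regret constants.

*Reduction to detours.* In the line network the regret of a path is the sum of the regrets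
`1 / θ i - 1 / θ (ζ i)` of its links. If `pstar` is not optimal under a confusing parameter `lam`,
then some link `i` has `lam i > lam (ζ i)`, and the detour through `i` (the path `pstar` with `ζ i`
replaced by `i`) detects `lam` with information at least `K i`, the divergence obtained when `i` is
exactly as good as the best link. So exploring the detours at rates `1 / K i` is feasible.
Conversely, raising only `θ i` to slightly above `θ (ζ i)` gives a confusing parameter that only the
paths through `i` detect, each with information at most `K i` up to an arbitrarily small error, so
that these paths need a total rate of `1 / K i`. This is `lowerBoundProgram_eq_sum`. Hop-by-hop
routing is the same program with the information and the regret of a path scaled by its throughput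
(`KLG_eq_mul_KLBer`).

*Comparison of delay laws.* Laws on `ℕ` are represented by their generating functions, power series
over `ℝ`, so that the delay law of a path is a product of the series of its links. For `u ≤ v` the
geometric law with parameter `u` is the one with parameter `v` plus an independent nonnegative delay
(`geoSeries_mul_extraDelaySeries`).
* By the data processing inequality (`IsLaw.klMass_mul_le`), among the paths through `i` the detour,
  whose other links are fastest, carries the most information about `i`.
* With bandit feedback the confusing parameter may permute the parameters on `pstar`. The divergence
  on the detour is nevertheless at least `K i`: under `lam` the delay law of `pstar` is unchanged,
  and the law of the detour arises from it by speeding up one geometric component, which decreases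
  it in the likelihood ratio order, because sums of geometric variables have log-concave laws
  (`geoSeries_likelihoodRatio`). The true law of the detour is larger than that of `pstar`, hence
  its divergence from the faster law is larger (`IsLaw.klMass_le_of_likelihoodRatio`).
-/

/-! ### Divergences of mass functions -/

section Divergence

theorem sub_le_mul_log_div {x y : ℝ} (hx : 0 ≤ x) (hy : 0 ≤ y) (h : y = 0 → x = 0) :
    x - y ≤ x * Real.log (x / y) := by
  rcases hx.eq_or_lt with rfl | hx
  · simpa using hy
  have hy' : 0 < y := lt_of_le_of_ne hy fun h' => hx.ne' (h h'.symm)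
  have := mul_le_mul_of_nonneg_left (Real.one_sub_inv_le_log_of_pos (div_pos hx hy')) hx.le
  rw [inv_div, mul_sub, mul_div_cancel₀ _ hx.ne', mul_one] at this
  exact this

/-- The log-sum inequality. -/
theorem sum_mul_log_div_le {ι : Type*} (s : Finset ι) (a b : ι → ℝ) (ha : ∀ i ∈ s, 0 ≤ a i)
    (hb : ∀ i ∈ s, 0 ≤ b i) (h : ∀ i ∈ s, b i = 0 → a i = 0) :
    (∑ i ∈ s, a i) * Real.log ((∑ i ∈ s, a i) / ∑ i ∈ s, b i) ≤
      ∑ i ∈ s, a i * Real.log (a i / b i) := by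
  set A := ∑ i ∈ s, a i with hA
  set B := ∑ i ∈ s, b i with hB
  have hA0 : 0 ≤ A := Finset.sum_nonneg ha
  rcases hA0.eq_or_lt with h0 | hApos
  · have hz : ∀ i ∈ s, a i = 0 := (Finset.sum_eq_zero_iff_of_nonneg ha).1 h0.symm
    rw [← h0, Finset.sum_eq_zero fun i hi => by rw [hz i hi, zero_mul]]
    simp
  have hBpos : 0 < B := by
    refine lt_of_le_of_ne (Finset.sum_nonneg hb) fun h0 => hApos.ne' ?_
    have hz := (Finset.sum_eq_zero_iff_of_nonneg hb).1 h0.symm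
    exact Finset.sum_eq_zero fun i hi => h i hi (hz i hi)
  -- compare `a i` with `b i * (A / B)`, which has the same total
  have key : ∀ i ∈ s, a i * Real.log (A / B) + (a i - b i * (A / B)) ≤
      a i * Real.log (a i / b i) := by
    intro i hi
    rcases (ha i hi).eq_or_lt with h0 | hai
    · rw [← h0]
      have := mul_nonneg (hb i hi) (div_pos hApos hBpos).le
      simpa using this
    have hbi : 0 < b i := lt_of_le_of_ne (hb i hi) fun h' => hai.ne' (h i hi h'.symm)
    have h1 := sub_le_mul_log_div hai.le (mul_pos hbi (div_pos hApos hBpos)).le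
      fun h' => absurd h' (mul_pos hbi (div_pos hApos hBpos)).ne'
    rw [← div_div, Real.log_div (div_pos hai hbi).ne' (div_pos hApos hBpos).ne'] at h1
    linarith
  have := Finset.sum_le_sum key
  rw [Finset.sum_add_distrib, Finset.sum_sub_distrib, ← Finset.sum_mul, ← Finset.sum_mul, ← hA,
    ← hB, mul_div_cancel₀ _ hBpos.ne', sub_self, add_zero] at this
  exact this

/-- To bound a divergence `klMass f g` by another one, only an upper bound on its terms is needed:
they are at least `f a - g a`, so that their negative parts are summable. -/
theorem klMass_le_add {α β : Type*} {f g : α → ℝ} {f' g' : β → ℝ} {c : ℝ} (hf : ∀ a, 0 ≤ f a)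
    (hg : ∀ a, 0 ≤ g a) (hfs : Summable f) (hgs : Summable g)
    (h : (∀ b, g' b = 0 → f' b = 0) → Summable (fun b => f' b * Real.log (f' b / g' b)) →
      (∀ a, g a = 0 → f a = 0) ∧ ∃ u : α → ℝ, (∀ a, f a * Real.log (f a / g a) ≤ u a) ∧
        HasSum u ((∑' b, f' b * Real.log (f' b / g' b)) + c)) :
    klMass f g ≤ klMass f' g' + ENNReal.ofReal c := by
  classical
  by_cases h' : (∀ b, g' b = 0 → f' b = 0) ∧ Summable (fun b => f' b * Real.log (f' b / g' b))
  · obtain ⟨hac, u, hu, hsum⟩ := h h'.1 h'.2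
    have hlow : ∀ a, f a - g a ≤ f a * Real.log (f a / g a) :=
      fun a => sub_le_mul_log_div (hf a) (hg a) (hac a)
    have hs : Summable (fun a => f a * Real.log (f a / g a)) := by
      have h1 : Summable fun a => f a * Real.log (f a / g a) - (f a - g a) :=
        Summable.of_nonneg_of_le (fun a => sub_nonneg.2 (hlow a))
          (fun a => sub_le_sub_right (hu a) _) (hsum.summable.sub (hfs.sub hgs))
      simpa using h1.add (hfs.sub hgs)
    unfold klMass
    rw [if_pos ⟨hac, hs⟩, if_pos h']
    refine le_trans (ENNReal.ofReal_le_ofReal ?_) ENNReal.ofReal_add_le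
    rw [← hsum.tsum_eq]
    exact hs.tsum_le_tsum hu hsum.summable
  · have : klMass f' g' = ∞ := by
      unfold klMass
      rw [if_neg h']
    rw [this, top_add]
    exact le_top

theorem klMass_self {α : Type*} (f : α → ℝ) : klMass f f = 0 := by
  simp [klMass]

/-- If `g'` is at least `g` tilted by the factor `r ^ k`, then replacing `g` by `g'` increases the
divergence from `f` by at most `log (1 / r)` times the mean of `f`. -/
theorem klMass_le_of_tilt {f g g' : ℕ → ℝ} {r : ℝ} (hr : 0 < r) (hf : ∀ k, 0 ≤ f k)
    (hg : ∀ k, 0 ≤ g k) (hfs : Summable f) (hgs' : Summable g')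
    (hm : Summable fun k : ℕ => (k : ℝ) * f k) (h : ∀ k, r ^ k * g k ≤ g' k) :
    klMass f g' ≤ klMass f g + ENNReal.ofReal (Real.log (1 / r) * ∑' k : ℕ, (k : ℝ) * f k) := by
  have hg' : ∀ k, 0 ≤ g' k := fun k => le_trans (mul_nonneg (pow_pos hr k).le (hg k)) (h k)
  refine klMass_le_add hf hg' hfs hgs' fun hac hs => ⟨fun k hk => hac k ?_,
    fun k => f k * Real.log (f k / g k) + Real.log (1 / r) * (k * f k), fun k => ?_,
    hs.hasSum.add (hm.hasSum.mul_left _)⟩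
  · have h1 := h k
    rw [hk] at h1
    exact le_antisymm (nonpos_of_mul_nonpos_right h1 (pow_pos hr k)) (hg k)
  · rcases (hf k).eq_or_lt with h0 | hpos
    · simp [← h0]
    have hgk : 0 < g k := lt_of_le_of_ne (hg k) fun h' => hpos.ne' (hac k h'.symm)
    have hrk := pow_pos hr k
    have h1 : Real.log (f k / g' k) ≤ Real.log (f k / g k / r ^ k) := by
      rw [div_div, mul_comm (g k)]
      have := mul_pos hrk hgk
      exact Real.log_le_log (div_pos hpos (this.trans_le (h k))) (by gcongr; exact h k)
    rw [Real.log_div (div_pos hpos hgk).ne' hrk.ne', Real.log_pow] at h1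
    rw [one_div, Real.log_inv]
    nlinarith [mul_le_mul_of_nonneg_left h1 hpos.le]

end Divergence

/-! ### Generating functions of laws -/

section Law

open PowerSeries

/-- `F` is the generating function of a probability law on `ℕ`. Sums of independent delays become
products of power series. -/
structure IsLaw (F : PowerSeries ℝ) : Prop where
  nonneg : ∀ k, 0 ≤ coeff k F
  hasSum : HasSum (fun k => coeff k F) 1

theorem coeff_mul_nonneg {F G : PowerSeries ℝ} (hF : ∀ k, 0 ≤ coeff k F) (hG : ∀ k, 0 ≤ coeff k G)
    (k : ℕ) : 0 ≤ coeff k (F * G) := by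
  rw [coeff_mul]
  exact Finset.sum_nonneg fun x _ => mul_nonneg (hF _) (hG _)

theorem hasSum_antidiagonal_mul {f g : ℕ → ℝ} {a b : ℝ} (hf : HasSum f a) (hg : HasSum g b) :
    HasSum (fun n => ∑ x ∈ Finset.HasAntidiagonal.antidiagonal n, f x.1 * g x.2) (a * b) := by
  have hf' := hf.summable.norm
  have hg' := hg.summable.norm
  have h := tsum_mul_tsum_eq_tsum_sum_antidiagonal_of_summable_norm hf' hg'
  rw [hf.tsum_eq, hg.tsum_eq] at h
  rw [h]
  exact (summable_norm_sum_mul_antidiagonal_of_summable_norm hf' hg').of_norm.hasSum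

namespace IsLaw

variable {F G S : PowerSeries ℝ}

theorem one : IsLaw 1 where
  nonneg k := by rw [coeff_one]; split_ifs <;> norm_num
  hasSum := by
    simp only [coeff_one]
    exact hasSum_ite_eq 0 (1 : ℝ)

theorem mul (hF : IsLaw F) (hG : IsLaw G) : IsLaw (F * G) where
  nonneg := coeff_mul_nonneg hF.nonneg hG.nonneg
  hasSum := by
    simp only [coeff_mul]
    simpa using hasSum_antidiagonal_mul hF.hasSum hG.hasSum

theorem prod {ι : Type*} {s : Finset ι} {F : ι → PowerSeries ℝ} (h : ∀ i ∈ s, IsLaw (F i)) :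
    IsLaw (∏ i ∈ s, F i) :=
  Finset.prod_induction F IsLaw (fun _ _ => mul) one h

/-- Data processing: adding the same independent term to both laws does not increase the
divergence. -/
theorem klMass_mul_le (hF : IsLaw F) (hG : IsLaw G) (hS : IsLaw S) :
    klMass (fun k => coeff k (F * S)) (fun k => coeff k (G * S)) ≤
      klMass (fun k => coeff k F) (fun k => coeff k G) := by
  have hFS := hF.mul hS
  have hGS := hG.mul hS
  rw [← add_zero (klMass (fun k => coeff k F) _), ← ENNReal.ofReal_zero]
  refine klMass_le_add hFS.nonneg hGS.nonneg hFS.hasSum.summable hGS.hasSum.summable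
    fun hac hs => ⟨fun k hk => ?_, fun k => ∑ x ∈ Finset.HasAntidiagonal.antidiagonal k,
      (coeff x.1 F * Real.log (coeff x.1 F / coeff x.1 G)) * coeff x.2 S, fun k => ?_, ?_⟩
  · rw [coeff_mul] at hk ⊢
    have hz := (Finset.sum_eq_zero_iff_of_nonneg
      fun x _ => mul_nonneg (hG.nonneg x.1) (hS.nonneg x.2)).1 hk
    refine Finset.sum_eq_zero fun x hx => ?_
    rcases mul_eq_zero.1 (hz x hx) with h | h
    · rw [hac _ h, zero_mul]
    · rw [h, mul_zero]
  · rw [coeff_mul, coeff_mul]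
    refine (sum_mul_log_div_le _ _ _ (fun x _ => mul_nonneg (hF.nonneg x.1) (hS.nonneg x.2))
      (fun x _ => mul_nonneg (hG.nonneg x.1) (hS.nonneg x.2)) fun x _ h => ?_).trans
      (Finset.sum_le_sum fun x _ => le_of_eq ?_)
    · rcases mul_eq_zero.1 h with h | h
      · rw [hac _ h, zero_mul]
      · rw [h, mul_zero]
    · rcases eq_or_ne (coeff x.2 S) 0 with h | h
      · simp [h]
      · rw [mul_div_mul_right _ _ h]; ring
  · simpa using hasSum_antidiagonal_mul hs.hasSum hS.hasSum

/-- If `F` is a delayed version of `G`, and `G'` is smaller than `G` in the likelihood ratio order,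
then `G'` is farther from `F` than `G`. -/
theorem klMass_le_of_likelihoodRatio {G' : PowerSeries ℝ} (hG : IsLaw G) (hG' : IsLaw G')
    (hS : IsLaw S) (hac' : ∀ k, coeff k G = 0 → coeff k G' = 0)
    (hlr : ∀ j k, j ≤ k → coeff j G * coeff k G' ≤ coeff j G' * coeff k G) :
    klMass (fun k => coeff k (G * S)) (fun k => coeff k G) ≤
      klMass (fun k => coeff k (G * S)) (fun k => coeff k G') := by
  have hF := hG.mul hS
  have hGS := hG'.mul hS
  set F := G * S with hFdef
  rw [← add_zero (klMass (fun k => coeff k F) (fun k => coeff k G')), ← ENNReal.ofReal_zero]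
  -- `∑ F log (G / G') ≥ ∑ F (1 - G' / G)`, and `F G' / G ≤ G' * S` by the likelihood ratio order
  refine klMass_le_add hF.nonneg hG.nonneg hF.hasSum.summable hG.hasSum.summable
    fun hac hs => ⟨fun k hk => hac k (hac' k hk), fun k =>
      coeff k F * Real.log (coeff k F / coeff k G') + (coeff k (G' * S) - coeff k F),
      fun k => ?_, ?_⟩
  · rcases (hF.nonneg k).eq_or_lt with h0 | hpos
    · simpa [← h0] using hGS.nonneg k
    have hG'k : 0 < coeff k G' :=
      lt_of_le_of_ne (hG'.nonneg k) fun h' => hpos.ne' (hac k h'.symm)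
    have hGk : 0 < coeff k G :=
      lt_of_le_of_ne (hG.nonneg k) fun h' => hG'k.ne' (hac' k h'.symm)
    have h1 : coeff k F * coeff k G' ≤ coeff k (G' * S) * coeff k G := by
      rw [hFdef, coeff_mul, coeff_mul, Finset.sum_mul, Finset.sum_mul]
      refine Finset.sum_le_sum fun x hx => ?_
      have hxk : x.1 ≤ k := by have := Finset.HasAntidiagonal.mem_antidiagonal.1 hx; omega
      have := mul_le_mul_of_nonneg_right (hlr x.1 k hxk) (hS.nonneg x.2)
      linarith
    have h2 := mul_le_mul_of_nonneg_left (Real.one_sub_inv_le_log_of_pos (div_pos hGk hG'k)) hpos.le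
    rw [inv_div] at h2
    have h3 : coeff k F * (coeff k G' / coeff k G) ≤ coeff k (G' * S) := by
      rw [← mul_div_assoc, div_le_iff₀ hGk]
      exact h1
    have h4 : Real.log (coeff k F / coeff k G) =
        Real.log (coeff k F / coeff k G') - Real.log (coeff k G / coeff k G') := by
      rw [Real.log_div hpos.ne' hGk.ne', Real.log_div hpos.ne' hG'k.ne',
        Real.log_div hGk.ne' hG'k.ne']
      ring
    rw [h4]
    linarith
  · simpa using hs.hasSum.add (hGS.hasSum.sub hF.hasSum)

/-- The mean of a sum of two independent delays is finite if their means are. -/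
theorem summable_mean_mul (hF : IsLaw F) (hG : IsLaw G)
    (hFm : Summable fun k : ℕ => (k : ℝ) * coeff k F)
    (hGm : Summable fun k : ℕ => (k : ℝ) * coeff k G) :
    Summable fun k : ℕ => (k : ℝ) * coeff k (F * G) := by
  have h := (hasSum_antidiagonal_mul hFm.hasSum hG.hasSum).summable.add
    (hasSum_antidiagonal_mul hF.hasSum hGm.hasSum).summable
  refine h.congr fun k => ?_
  rw [coeff_mul, ← Finset.sum_add_distrib, Finset.mul_sum]
  refine Finset.sum_congr rfl fun x hx => ?_
  rw [← Finset.HasAntidiagonal.mem_antidiagonal.1 hx]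
  push_cast
  ring

end IsLaw

end Law

/-! ### Log-concave sequences -/

section LogConcave

open PowerSeries

/-- The coefficients of `G` are nonnegative and form a log-concave sequence without internal zeros,
stated as `g m * g (m + k + l) ≤ g (m + k) * g (m + l)`. -/
structure IsLogConcave (G : PowerSeries ℝ) : Prop where
  nonneg : ∀ k, 0 ≤ coeff k G
  mul_le : ∀ m k l, coeff m G * coeff (m + k + l) G ≤ coeff (m + k) G * coeff (m + l) G

/-- The geometric series `∑ n, a ^ n X ^ n = 1 / (1 - a X)`. -/
noncomputable def geomSeries (a : ℝ) : PowerSeries ℝ := PowerSeries.mk fun n => a ^ n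

theorem coeff_geomSeries (a : ℝ) (n : ℕ) : coeff n (geomSeries a) = a ^ n := coeff_mk _ _

theorem geomSeries_mul_one_sub (a : ℝ) : geomSeries a * (1 - C a * X) = 1 := by
  ext n
  cases n with
  | zero => simp [geomSeries]
  | succ n =>
    rw [mul_sub, mul_one, mul_comm (C a), ← mul_assoc, map_sub, coeff_mul_C, coeff_succ_mul_X,
      coeff_geomSeries, coeff_geomSeries, coeff_one]
    simp [pow_succ]

theorem geomSeries_eq_add (a b : ℝ) :
    geomSeries a = geomSeries b + C (a - b) * X * (geomSeries a * geomSeries b) := by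
  have ha := geomSeries_mul_one_sub a
  have hb := geomSeries_mul_one_sub b
  rw [map_sub]
  linear_combination geomSeries b * ha - geomSeries a * hb

theorem coeff_geomSeries_mul (a : ℝ) (G : PowerSeries ℝ) (n : ℕ) :
    coeff n (geomSeries a * G) = ∑ i ∈ Finset.range (n + 1), a ^ i * coeff (n - i) G := by
  rw [coeff_mul, Finset.Nat.sum_antidiagonal_eq_sum_range_succ_mk]
  simp only [coeff_geomSeries]

theorem coeff_succ_geomSeries_mul (a : ℝ) (G : PowerSeries ℝ) (n : ℕ) :
    coeff (n + 1) (geomSeries a * G) = a * coeff n (geomSeries a * G) + coeff (n + 1) G := by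
  have h : geomSeries a * G = C a * (X * (geomSeries a * G)) + G := by
    linear_combination G * geomSeries_mul_one_sub a
  conv_lhs => rw [h]
  rw [map_add, coeff_C_mul, coeff_succ_X_mul]

namespace IsLogConcave

variable {G : PowerSeries ℝ}

theorem one : IsLogConcave 1 where
  nonneg k := by rw [coeff_one]; split_ifs <;> norm_num
  mul_le m k l := by
    simp only [coeff_one]
    split_ifs <;> first | omega | norm_num

theorem C_mul (hG : IsLogConcave G) {c : ℝ} (hc : 0 ≤ c) : IsLogConcave (C c * G) where
  nonneg k := by rw [coeff_C_mul]; exact mul_nonneg hc (hG.nonneg k)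
  mul_le m k l := by
    simp only [coeff_C_mul]
    have := mul_le_mul_of_nonneg_left (hG.mul_le m k l) (mul_nonneg hc hc)
    linarith

theorem X_mul (hG : IsLogConcave G) : IsLogConcave (X * G) where
  nonneg k := by
    cases k with
    | zero => rw [coeff_zero_X_mul]
    | succ k => rw [coeff_succ_X_mul]; exact hG.nonneg k
  mul_le m k l := by
    cases m with
    | zero =>
      rw [coeff_zero_X_mul, zero_mul, zero_add, zero_add]
      refine mul_nonneg ?_ ?_
      · cases k with
        | zero => rw [coeff_zero_X_mul]
        | succ k => rw [coeff_succ_X_mul]; exact hG.nonneg k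
      · cases l with
        | zero => rw [coeff_zero_X_mul]
        | succ k => rw [coeff_succ_X_mul]; exact hG.nonneg k
    | succ m =>
      rw [show m + 1 + k + l = m + k + l + 1 by ring, show m + 1 + k = m + k + 1 by ring,
        show m + 1 + l = m + l + 1 by ring]
      simp only [coeff_succ_X_mul]
      exact hG.mul_le m k l

/-- With `A = G / (1 - a X)`, the ratios `A n / G (n + 1)` are nondecreasing. -/
theorem coeff_mul_geomSeries_le (hG : IsLogConcave G) {a : ℝ} (ha : 0 ≤ a) {j n : ℕ} (h : j ≤ n) :
    coeff j (geomSeries a * G) * coeff (n + 1) G ≤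
      coeff (j + 1) G * coeff n (geomSeries a * G) := by
  rw [coeff_geomSeries_mul, coeff_geomSeries_mul, Finset.sum_mul, Finset.mul_sum]
  have hsub : Finset.range (j + 1) ⊆ Finset.range (n + 1) := Finset.range_mono (by omega)
  refine le_trans (Finset.sum_le_sum fun i hi => ?_)
    (Finset.sum_le_sum_of_subset_of_nonneg hsub fun i _ _ =>
      mul_nonneg (hG.nonneg _) (mul_nonneg (pow_nonneg ha i) (hG.nonneg _)))
  have hi' : i ≤ j := by have := Finset.mem_range.1 hi; omega
  have := mul_le_mul_of_nonneg_left (hG.mul_le (j - i) (i + 1) (n - j)) (pow_nonneg ha i)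
  rw [show j - i + (i + 1) + (n - j) = n + 1 by omega, show j - i + (i + 1) = j + 1 by omega,
    show j - i + (n - j) = n - i by omega] at this
  linarith

/-- It suffices to move the two indices closer by one step. -/
theorem of_step (h0 : ∀ k, 0 ≤ coeff k G)
    (h : ∀ m l, coeff m G * coeff (m + l + 1) G ≤ coeff (m + 1) G * coeff (m + l) G) :
    IsLogConcave G where
  nonneg := h0
  mul_le m k l := by
    induction k generalizing m l with
    | zero => simp
    | succ k ih =>
      cases l with
      | zero => simp [mul_comm]
      | succ l =>
        have h1 := h m (k + 1 + l)
        have h2 := ih (m + 1) l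
        rw [show m + 1 + k + l = m + (k + 1 + l) by ring, show m + 1 + k = m + (k + 1) by ring,
          show m + 1 + l = m + (l + 1) by ring] at h2
        rw [show m + (k + 1 + l) + 1 = m + (k + 1) + (l + 1) by ring] at h1
        exact h1.trans h2

theorem geomSeries_mul (hG : IsLogConcave G) {a : ℝ} (ha : 0 ≤ a) :
    IsLogConcave (geomSeries a * G) := by
  refine of_step (coeff_mul_nonneg (fun k => ?_) hG.nonneg) fun m l => ?_
  · rw [coeff_geomSeries]
    exact pow_nonneg ha k
  · rw [coeff_succ_geomSeries_mul, coeff_succ_geomSeries_mul]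
    linarith [hG.coeff_mul_geomSeries_le ha (Nat.le_add_right m l)]

/-- For log-concave `G`, the quotients of `G / (1 - a X)` and `G / (1 - b X)` with `b ≤ a` are
nondecreasing. -/
theorem geomSeries_likelihoodRatio (hG : IsLogConcave G) {a b : ℝ} (hb : 0 ≤ b) (hab : b ≤ a)
    {j k : ℕ} (h : j ≤ k) :
    coeff j (geomSeries a * G) * coeff k (geomSeries b * G) ≤
      coeff j (geomSeries b * G) * coeff k (geomSeries a * G) := by
  have hB := hG.geomSeries_mul hb
  have ha := hb.trans hab
  have hA := hB.geomSeries_mul ha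
  have e : geomSeries a * G = geomSeries b * G +
      C (a - b) * (X * (geomSeries a * (geomSeries b * G))) := by
    conv_lhs => rw [geomSeries_eq_add a b]
    ring
  set B := geomSeries b * G
  rw [e]
  cases k with
  | zero =>
    obtain rfl : j = 0 := by omega
    exact (mul_comm _ _).le
  | succ k =>
    cases j with
    | zero =>
      simp only [map_add, coeff_C_mul, coeff_zero_X_mul, coeff_succ_X_mul]
      have := mul_nonneg (hB.nonneg 0) (mul_nonneg (sub_nonneg.2 hab) (hA.nonneg k))
      linarith
    | succ j =>
      simp only [map_add, coeff_C_mul, coeff_succ_X_mul]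
      have := mul_le_mul_of_nonneg_left (hB.coeff_mul_geomSeries_le ha (show j ≤ k by omega))
        (sub_nonneg.2 hab)
      linarith

end IsLogConcave

end LogConcave

/-! ### Geometric laws -/

section Geometric

open PowerSeries

/-- Generating function of the geometric law on `{1, 2, …}` with parameter `u`. -/
noncomputable def geoSeries (u : ℝ) : PowerSeries ℝ := PowerSeries.mk (geoMass u)

theorem coeff_geoSeries (u : ℝ) (k : ℕ) : coeff k (geoSeries u) = geoMass u k := coeff_mk _ _

theorem geoSeries_eq (u : ℝ) : geoSeries u = C u * (X * geomSeries (1 - u)) := by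
  ext k
  rw [coeff_geoSeries, coeff_C_mul]
  cases k with
  | zero => simp [geoMass]
  | succ k => rw [coeff_succ_X_mul, coeff_geomSeries]; simp [geoMass]

theorem hasSum_coeff_X_mul {F : PowerSeries ℝ} {a : ℝ} (h : HasSum (fun k => coeff k F) a) :
    HasSum (fun k => coeff k (X * F)) a := by
  rw [← hasSum_nat_add_iff' 1]
  simpa [coeff_succ_X_mul] using h

theorem hasSum_coeff_geomSeries {u : ℝ} (h0 : 0 < u) (h1 : u ≤ 1) :
    HasSum (fun k => coeff k (geomSeries (1 - u))) u⁻¹ := by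
  simp only [coeff_geomSeries]
  simpa using hasSum_geometric_of_lt_one (sub_nonneg.2 h1) (by linarith)

theorem geoMass_nonneg {u : ℝ} (h0 : 0 < u) (h1 : u ≤ 1) (k : ℕ) : 0 ≤ geoMass u k := by
  unfold geoMass
  split_ifs
  · exact le_rfl
  · exact mul_nonneg h0.le (pow_nonneg (sub_nonneg.2 h1) _)

theorem isLaw_geoSeries {u : ℝ} (h0 : 0 < u) (h1 : u ≤ 1) : IsLaw (geoSeries u) where
  nonneg k := by rw [coeff_geoSeries]; exact geoMass_nonneg h0 h1 k
  hasSum := by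
    rw [geoSeries_eq]
    simp only [coeff_C_mul]
    simpa [h0.ne'] using (hasSum_coeff_X_mul (hasSum_coeff_geomSeries h0 h1)).mul_left u

theorem hasSum_geoMass {u : ℝ} (h0 : 0 < u) (h1 : u ≤ 1) : HasSum (geoMass u) 1 := by
  simpa only [coeff_geoSeries] using (isLaw_geoSeries h0 h1).hasSum

/-- Mean of the geometric law on `{0, 1, …}`. -/
theorem hasSum_sub_one_mul_geoMass {u : ℝ} (h0 : 0 < u) (h1 : u ≤ 1) :
    HasSum (fun k : ℕ => ((k : ℝ) - 1) * geoMass u k) ((1 - u) / u) := by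
  rw [← hasSum_nat_add_iff' 1]
  have h := (hasSum_coe_mul_geometric_of_norm_lt_one (r := 1 - u)
    (by rw [Real.norm_eq_abs, abs_lt]; constructor <;> linarith)).mul_left u
  have e : u * ((1 - u) / (1 - (1 - u)) ^ 2) =
      (1 - u) / u - ∑ i ∈ Finset.range 1, ((i : ℝ) - 1) * geoMass u i := by
    rw [sub_sub_cancel, Finset.sum_range_one, geoMass, if_pos rfl, mul_zero, sub_zero]
    field_simp
  rw [← e]
  refine h.congr_fun fun k => ?_
  simp [geoMass]
  ring

theorem summable_mean_geoSeries {u : ℝ} (h0 : 0 < u) (h1 : u ≤ 1) :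
    Summable fun k : ℕ => (k : ℝ) * coeff k (geoSeries u) := by
  refine ((hasSum_sub_one_mul_geoMass h0 h1).summable.add (hasSum_geoMass h0 h1).summable).congr
    fun k => ?_
  rw [coeff_geoSeries]
  ring

theorem isLaw_prod_geoSeries {E : Type*} {θ : E → ℝ} (hθ : IsLinkParam θ) (p : Finset E) :
    IsLaw (∏ i ∈ p, geoSeries (θ i)) :=
  .prod fun i _ => isLaw_geoSeries (hθ i).1 (hθ i).2

theorem summable_mean_prod_geoSeries {ι : Type*} {θ : ι → ℝ} (hθ : IsLinkParam θ) (s : Finset ι) :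
    Summable fun k : ℕ => (k : ℝ) * coeff k (∏ i ∈ s, geoSeries (θ i)) := by
  classical
  induction s using Finset.induction_on with
  | empty =>
    refine summable_zero.congr fun k => ?_
    rw [Finset.prod_empty, coeff_one]
    split_ifs with h <;> simp [h]
  | insert i s hi ih =>
    rw [Finset.prod_insert hi]
    exact (isLaw_geoSeries (hθ i).1 (hθ i).2).summable_mean_mul
      (isLaw_prod_geoSeries hθ s)
      (summable_mean_geoSeries (hθ i).1 (hθ i).2) ih

/-- Generating function of the law which, added independently to the geometric law with parameter
`v`, gives the geometric law with parameter `u ≤ v`. -/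
noncomputable def extraDelaySeries (u v : ℝ) : PowerSeries ℝ :=
  C (u / v) * (1 + C (v - u) * (X * geomSeries (1 - u)))

theorem geoSeries_mul_extraDelaySeries {u v : ℝ} (hv : v ≠ 0) :
    geoSeries v * extraDelaySeries u v = geoSeries u := by
  have h := geomSeries_eq_add (1 - u) (1 - v)
  rw [show (1 - u) - (1 - v) = v - u by ring] at h
  have hc : (C v : PowerSeries ℝ) * C (u / v) = C u := by rw [← map_mul, mul_div_cancel₀ _ hv]
  rw [geoSeries_eq, geoSeries_eq, extraDelaySeries, ← hc]
  linear_combination (-(C v * C (u / v) * X)) * h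

theorem coeff_extraDelaySeries_nonneg {u v : ℝ} (h0 : 0 < u) (h : u ≤ v) (h1 : v ≤ 1) (k : ℕ) :
    0 ≤ coeff k (extraDelaySeries u v) := by
  have huv : 0 ≤ u / v := div_nonneg h0.le (h0.le.trans h)
  rw [extraDelaySeries, coeff_C_mul, map_add, coeff_C_mul]
  refine mul_nonneg huv ?_
  cases k with
  | zero => simp
  | succ k =>
    rw [coeff_succ_X_mul, coeff_geomSeries, coeff_one, if_neg k.succ_ne_zero, zero_add]
    exact mul_nonneg (sub_nonneg.2 h) (pow_nonneg (by linarith) _)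

theorem isLaw_extraDelaySeries {u v : ℝ} (h0 : 0 < u) (h : u ≤ v) (h1 : v ≤ 1) :
    IsLaw (extraDelaySeries u v) where
  nonneg := coeff_extraDelaySeries_nonneg h0 h h1
  hasSum := by
    have hs := ((IsLaw.one.hasSum).add ((hasSum_coeff_X_mul
      (hasSum_coeff_geomSeries h0 (h.trans h1))).mul_left (v - u))).mul_left (u / v)
    simp only [extraDelaySeries, coeff_C_mul, map_add]
    have e : u / v * (1 + (v - u) * u⁻¹) = 1 := by
      have := (h0.trans_le h).ne'
      field_simp
      ring
    rwa [e] at hs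

theorem isLogConcave_prod_geoSeries {ι : Type*} {θ : ι → ℝ} (hθ : IsLinkParam θ) (s : Finset ι) :
    IsLogConcave (∏ i ∈ s, geoSeries (θ i)) := by
  classical
  induction s using Finset.induction_on with
  | empty => exact .one
  | insert i s hi ih =>
    rw [Finset.prod_insert hi, geoSeries_eq, mul_assoc, mul_assoc]
    exact (ih.geomSeries_mul (sub_nonneg.2 (hθ i).2)).X_mul.C_mul (hθ i).1.le

theorem geoSeries_likelihoodRatio {G : PowerSeries ℝ} (hG : IsLogConcave G) {v w : ℝ} (h0 : 0 < v)
    (hvw : v ≤ w) (h1 : w ≤ 1) {j k : ℕ} (h : j ≤ k) :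
    coeff j (geoSeries v * G) * coeff k (geoSeries w * G) ≤
      coeff j (geoSeries w * G) * coeff k (geoSeries v * G) := by
  rw [geoSeries_eq, geoSeries_eq, mul_assoc, mul_assoc, mul_assoc, mul_assoc]
  simp only [coeff_C_mul]
  cases k with
  | zero => rw [coeff_zero_X_mul]; simp
  | succ k =>
    cases j with
    | zero => rw [coeff_zero_X_mul, coeff_zero_X_mul]; simp
    | succ j =>
      simp only [coeff_succ_X_mul]
      have := mul_le_mul_of_nonneg_left (hG.geomSeries_likelihoodRatio (sub_nonneg.2 h1)
        (sub_le_sub_left hvw 1) (Nat.le_of_succ_le_succ h))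
        (mul_nonneg h0.le (h0.le.trans hvw))
      linarith

/-- The law `geoSeries v * G` is reached from its delayed version by removing the delay `S`. Going
further, by increasing the parameter `v` of a geometric component to `w`, increases the
divergence. -/
theorem klMass_mul_geoSeries_mono {G S : PowerSeries ℝ} (hG : IsLaw G) (hG' : IsLogConcave G)
    (hS : IsLaw S) {v w : ℝ} (h0 : 0 < v) (hvw : v ≤ w) (h1 : w ≤ 1) :
    klMass (fun k => coeff k (geoSeries v * G * S)) (fun k => coeff k (geoSeries v * G)) ≤
      klMass (fun k => coeff k (geoSeries v * G * S)) (fun k => coeff k (geoSeries w * G)) := by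
  have hw := h0.trans_le hvw
  have hwl := (isLaw_geoSeries hw h1).mul hG
  refine ((isLaw_geoSeries h0 (hvw.trans h1)).mul hG).klMass_le_of_likelihoodRatio
    hwl hS (fun k hk => ?_)
    fun j k hjk => geoSeries_likelihoodRatio hG' h0 hvw h1 hjk
  -- the support only grows when the extra delay, which may vanish, is added
  rw [← geoSeries_mul_extraDelaySeries hw.ne', mul_right_comm, coeff_mul] at hk
  have hx := isLaw_extraDelaySeries h0 hvw h1
  have h2 := (Finset.sum_eq_zero_iff_of_nonneg
    fun x _ => mul_nonneg (hwl.nonneg x.1) (hx.nonneg x.2)).1 hk (k, 0) (by simp)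
  refine (mul_eq_zero.1 h2).resolve_right ?_
  simp [extraDelaySeries, h0.ne', hw.ne']

theorem pow_mul_geoMass_le {v r : ℝ} (h1 : v ≤ 1) (hr : 0 ≤ r) (hr1 : r ≤ 1) (k : ℕ) :
    r ^ k * geoMass v k ≤ geoMass (1 - r * (1 - v)) k := by
  cases k with
  | zero => simp [geoMass]
  | succ k =>
    have hv := sub_nonneg.2 h1
    simp only [geoMass, Nat.succ_ne_zero, if_false, Nat.add_sub_cancel, sub_sub_cancel, mul_pow]
    have hp := mul_nonneg (pow_nonneg hr k) (pow_nonneg hv k)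
    have h2 : r * v ≤ 1 - r * (1 - v) := by nlinarith
    have := mul_le_mul_of_nonneg_right h2 hp
    rw [pow_succ]
    linarith

/-- The divergence is upper semicontinuous when a geometric component of the second law is sped up
slightly. -/
theorem exists_klMass_mul_geoSeries_le {F G : PowerSeries ℝ} (hF : IsLaw F)
    (hm : Summable fun k : ℕ => (k : ℝ) * coeff k F) (hG : IsLaw G) {v : ℝ} (h0 : 0 < v)
    (h1 : v < 1) {δ : ℝ} (hδ : 0 < δ) :
    ∃ w, v < w ∧ w ≤ 1 ∧ klMass (fun k => coeff k F) (fun k => coeff k (geoSeries w * G)) ≤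
      klMass (fun k => coeff k F) (fun k => coeff k (geoSeries v * G)) + ENNReal.ofReal δ := by
  set m := ∑' k : ℕ, (k : ℝ) * coeff k F with hmdef
  have hm0 : 0 ≤ m := tsum_nonneg fun k => mul_nonneg k.cast_nonneg (hF.nonneg k)
  -- the tilt `r` is chosen such that `log (1 / r) * m ≤ δ`
  have hc : 0 < δ / (m + 1) := by positivity
  set r := Real.exp (-(δ / (m + 1))) with hr
  have hr0 : 0 < r := Real.exp_pos _
  have hr1 : r < 1 := Real.exp_lt_one_iff.2 (by linarith)
  have hv := sub_pos.2 h1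
  have hvw : v < 1 - r * (1 - v) := by nlinarith
  have hw1 : 1 - r * (1 - v) ≤ 1 := by nlinarith [mul_pos hr0 hv]
  refine ⟨1 - r * (1 - v), hvw, hw1, ?_⟩
  have hL := (isLaw_geoSeries h0 h1.le).mul hG
  have hL' := (isLaw_geoSeries (h0.trans hvw) hw1).mul hG
  refine (klMass_le_of_tilt hr0 hF.nonneg hL.nonneg hF.hasSum.summable hL'.hasSum.summable hm
    fun k => ?_).trans (add_le_add_right (ENNReal.ofReal_le_ofReal ?_) _)
  · rw [coeff_mul, coeff_mul, Finset.mul_sum]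
    refine Finset.sum_le_sum fun x hx => ?_
    rw [coeff_geoSeries, coeff_geoSeries, ← mul_assoc]
    refine mul_le_mul_of_nonneg_right ?_ (hG.nonneg _)
    refine le_trans ?_ (pow_mul_geoMass_le h1.le hr0.le hr1.le x.1)
    have hxk : x.1 ≤ k := by have := Finset.HasAntidiagonal.mem_antidiagonal.1 hx; omega
    exact mul_le_mul_of_nonneg_right (pow_le_pow_of_le_one hr0.le hr1.le hxk)
      (geoMass_nonneg h0 h1.le _)
  · rw [one_div, hr, ← Real.exp_neg, neg_neg, Real.log_exp, ← hmdef, div_mul_eq_mul_div,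
      div_le_iff₀ (by linarith)]
    nlinarith

end Geometric

/-! ### Divergence between geometric laws -/

section GeometricDivergence

open PowerSeries

theorem KLG_eq_klMass_coeff (u v : ℝ) :
    KLG u v = klMass (fun k => coeff k (geoSeries u)) (fun k => coeff k (geoSeries v)) := by
  simp only [coeff_geoSeries]
  rfl

theorem KLG_mono {u v w : ℝ} (h0 : 0 < u) (huv : u ≤ v) (hvw : v ≤ w) (h1 : w ≤ 1) :
    KLG u v ≤ KLG u w := by
  have h := klMass_mul_geoSeries_mono IsLaw.one IsLogConcave.one
    (isLaw_extraDelaySeries h0 huv (hvw.trans h1)) (h0.trans_le huv) hvw h1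
  simpa only [mul_one, geoSeries_mul_extraDelaySeries (h0.trans_le huv).ne',
    ← KLG_eq_klMass_coeff] using h

theorem KLG_one_right {u : ℝ} (h0 : 0 < u) (h1 : u < 1) : KLG u 1 = ∞ := by
  unfold KLG klMass
  refine if_neg fun h => ?_
  have := h.1 2 (by simp [geoMass])
  simp [geoMass, h0.ne', sub_eq_zero, h1.ne'] at this

theorem hasSum_geoMass_mul_log {u v : ℝ} (h0 : 0 < u) (h1 : u ≤ 1) (hv : 0 < v) (hv1 : v < 1) :
    HasSum (fun k => geoMass u k * Real.log (geoMass u k / geoMass v k))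
      (Real.log (u / v) + (1 - u) / u * Real.log ((1 - u) / (1 - v))) := by
  have h := ((hasSum_geoMass h0 h1).mul_right (Real.log (u / v))).add
    ((hasSum_sub_one_mul_geoMass h0 h1).mul_right (Real.log ((1 - u) / (1 - v))))
  rw [one_mul] at h
  refine h.congr_fun ?_
  intro k
  rcases k with _ | k
  · simp [geoMass]
  rcases h1.eq_or_lt with rfl | h1
  · rcases k with _ | k <;> simp [geoMass]
  · have hu := sub_pos.2 h1
    have hv' := sub_pos.2 hv1
    simp only [geoMass, Nat.succ_ne_zero, if_false, Nat.add_sub_cancel]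
    rw [mul_div_mul_comm, ← div_pow, Real.log_mul (div_pos h0 hv).ne'
      (pow_pos (div_pos hu hv') k).ne', Real.log_pow]
    push_cast
    ring

theorem geoMass_eq_zero_of_lt_one {u v : ℝ} (hv : 0 < v) (hv1 : v < 1) (k : ℕ)
    (h : geoMass v k = 0) : geoMass u k = 0 := by
  cases k with
  | zero => simp [geoMass]
  | succ k =>
    simp [geoMass, hv.ne', (sub_pos.2 hv1).ne'] at h

theorem KLG_of_lt_one {u v : ℝ} (h0 : 0 < u) (h1 : u ≤ 1) (hv : 0 < v) (hv1 : v < 1) :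
    KLG u v =
      ENNReal.ofReal (Real.log (u / v) + (1 - u) / u * Real.log ((1 - u) / (1 - v))) := by
  have hs := hasSum_geoMass_mul_log h0 h1 hv hv1
  unfold KLG klMass
  rw [if_pos ⟨geoMass_eq_zero_of_lt_one hv hv1, hs.summable⟩, hs.tsum_eq]

theorem KLG_ne_top {u v : ℝ} (h0 : 0 < u) (h1 : u ≤ 1) (hv : 0 < v) (hv1 : v < 1) :
    KLG u v ≠ ∞ := by
  rw [KLG_of_lt_one h0 h1 hv hv1]
  exact ENNReal.ofReal_ne_top

/-- A packet makes `1 / u` attempts on average, each of which carries the information of one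
Bernoulli trial. -/
theorem KLG_eq_mul_KLBer {u v : ℝ} (h0 : 0 < u) (h1 : u ≤ 1) (hv : 0 < v) (hv1 : v ≤ 1) :
    KLG u v = ENNReal.ofReal (1 / u) * KLBer u v := by
  rcases hv1.lt_or_eq with hv1 | rfl
  · have hac : ∀ b, berMass v b = 0 → berMass u b = 0 := by
      intro b
      cases b <;> simp [berMass, hv.ne', (sub_pos.2 hv1).ne']
    rw [KLG_of_lt_one h0 h1 hv hv1]
    unfold KLBer klMass
    rw [if_pos ⟨hac, Summable.of_finite⟩, ← ENNReal.ofReal_mul (by positivity), tsum_fintype,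
      Fintype.sum_bool]
    congr 1
    simp only [berMass, if_true, Bool.false_eq_true, if_false]
    field_simp
  · rcases h1.lt_or_eq with h1 | rfl
    · rw [KLG_one_right h0 h1]
      have : KLBer u 1 = ∞ := by
        unfold KLBer klMass
        refine if_neg fun h => ?_
        have := h.1 false (by simp [berMass])
        simp [berMass, sub_eq_zero, h1.ne'] at this
      rw [this, ENNReal.mul_top]
      simpa using h0
    · unfold KLG KLBer
      rw [klMass_self, klMass_self, mul_zero]

end GeometricDivergence

/-! ### Delay laws of paths -/

section PathDelay

open PowerSeries

theorem pathDelayMass_eq_coeff {E : Type*} [DecidableEq E] (θ : E → ℝ) (p : Finset E) :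
    pathDelayMass θ p = fun k => coeff k (∏ i ∈ p, geoSeries (θ i)) := by
  ext k
  rw [coeff_prod, pathDelayMass, Finset.finsuppAntidiag, Finset.sum_map]
  simp only [coeff_geoSeries]
  exact (Finset.sum_attach _ fun d : E → ℕ => ∏ i ∈ p, geoMass (θ i) (d i)).symm

end PathDelay

/-! ### Paths of the line network -/

section LinePaths

theorem lineNetwork_isWalk_iff {E : Type*} {H : ℕ} (hop : E → Fin H) (l : List E)
    (v w : Fin (H + 1)) :
    (lineNetwork hop).IsWalk v l w ↔
      l.map (fun e => (hop e : ℕ)) = List.range' v l.length ∧ (w : ℕ) = v + l.length := by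
  induction l generalizing v with
  | nil =>
    simp only [RoutingNetwork.IsWalk, List.map_nil, List.length_nil, List.range'_zero, true_and,
      add_zero, Fin.ext_iff]
    exact eq_comm
  | cons e l ih =>
    rw [RoutingNetwork.IsWalk, ih]
    simp only [lineNetwork, List.map_cons, List.length_cons, List.range'_succ, List.cons.injEq,
      Fin.ext_iff, Fin.val_castSucc, Fin.val_succ]
    constructor
    · rintro ⟨h1, h2, h3⟩
      rw [h1] at h2 h3
      exact ⟨⟨h1, h2⟩, by omega⟩
    · rintro ⟨⟨h1, h2⟩, h3⟩
      rw [h1]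
      exact ⟨rfl, h2, by omega⟩

variable {E : Type*} [Fintype E] [DecidableEq E] {H : ℕ} {hop : E → Fin H}

/-- The paths of the line network are the sets that contain exactly one link of each hop. -/
theorem mem_paths_lineNetwork {p : Finset E} :
    p ∈ (lineNetwork hop).paths ↔ Set.InjOn hop p ∧ ∀ h, ∃ i ∈ p, hop i = h := by
  simp only [RoutingNetwork.paths, Finset.mem_filter, Finset.mem_univ, true_and,
    RoutingNetwork.IsPath, lineNetwork_isWalk_iff]
  constructor
  · rintro ⟨l, ⟨hl, hlen⟩, -, rfl⟩
    have hlen' : l.length = H := by simpa [lineNetwork] using hlen.symm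
    have hnd : (l.map fun e => (hop e : ℕ)).Nodup := by rw [hl]; exact List.nodup_range'
    refine ⟨fun a ha b hb hab => ?_, fun h => ?_⟩
    · exact List.inj_on_of_nodup_map hnd (by simpa using ha) (by simpa using hb)
        (by rw [hab])
    · have hmem : (h : ℕ) ∈ l.map fun e => (hop e : ℕ) := by
        rw [hl, hlen', List.mem_range'_1]
        simp [lineNetwork]
      obtain ⟨i, hi, hih⟩ := List.mem_map.1 hmem
      exact ⟨i, by simpa using hi, Fin.ext hih⟩
  · rintro ⟨hinj, hsurj⟩
    choose s hsp hs using hsurj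
    have hmap : (List.ofFn s).map (fun e => (hop e : ℕ)) = List.range' 0 H := by
      rw [List.map_ofFn]
      refine List.ext_getElem (by simp) fun n h1 h2 => ?_
      simp [hs]
    refine ⟨List.ofFn s, ⟨?_, ?_⟩, ?_, ?_⟩
    · rw [hmap]
      simp [lineNetwork]
    · simp [lineNetwork]
    · have hv : (((lineNetwork hop).source :: (List.ofFn s).map (lineNetwork hop).head).map
          Fin.val) = List.range' 0 (H + 1) := by
        rw [List.range'_succ, List.map_cons, List.map_map]
        congr 1
        refine List.ext_getElem (by simp) fun n h1 h2 => ?_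
        simp [hs, lineNetwork, add_comm]
      exact List.Nodup.of_map _ (hv ▸ List.nodup_range')
    · ext i
      rw [List.mem_toFinset, List.mem_ofFn]
      constructor
      · rintro ⟨h, rfl⟩
        exact hsp h
      · intro hi
        exact ⟨hop i, hinj (hsp _) hi (hs _)⟩

theorem exchange_mem_paths {p : Finset E} (hp : p ∈ (lineNetwork hop).paths) {i j : E}
    (hj : j ∈ p) (h : hop i = hop j) : insert i (p.erase j) ∈ (lineNetwork hop).paths := by
  rw [mem_paths_lineNetwork] at hp ⊢
  obtain ⟨hinj, hsurj⟩ := hp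
  constructor
  · intro a ha b hb hab
    simp only [Finset.coe_insert, Finset.coe_erase, Set.mem_insert_iff, Set.mem_sdiff,
      Set.mem_singleton_iff, Finset.mem_coe] at ha hb
    rcases ha with rfl | ⟨ha, haj⟩ <;> rcases hb with rfl | ⟨hb, hbj⟩
    · rfl
    · exact absurd (hinj hb hj (hab.symm.trans h)) hbj
    · exact absurd (hinj ha hj (hab.trans h)) haj
    · exact hinj ha hb hab
  · intro k
    obtain ⟨x, hx, hxk⟩ := hsurj k
    by_cases hxj : x = j
    · exact ⟨i, Finset.mem_insert_self _ _, by rw [h, ← hxj, hxk]⟩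
    · exact ⟨x, Finset.mem_insert_of_mem (Finset.mem_erase.2 ⟨hxj, hx⟩), hxk⟩

end LinePaths

theorem avgDelay_exchange {E : Type*} [DecidableEq E] (lam : E → ℝ) {p : Finset E} {i j : E}
    (hi : i ∉ p) (hj : j ∈ p) :
    avgDelay lam (insert i (p.erase j)) + 1 / lam j = avgDelay lam p + 1 / lam i := by
  unfold avgDelay
  rw [Finset.sum_insert (by simp [hi]), ← Finset.add_sum_erase p _ hj]
  ring

/-- The features of the line network that determine the programs: `ζ` maps the links of each path
bijectively onto the optimal path `pstar`, it increases the parameter of each link outside `pstar`,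
and exchanging `ζ i` for `i` in `pstar` gives a path, the detour through `i`. -/
structure IsBestLinkMap {V E : Type*} [Fintype E] [DecidableEq E] (G : RoutingNetwork V E)
    (θ : E → ℝ) (pstar : Finset E) (ζ : E → E) : Prop where
  mem : ∀ i, ζ i ∈ pstar
  fixed : ∀ i ∈ pstar, ζ i = i
  lt : ∀ i, i ≠ ζ i → θ i < θ (ζ i)
  detour_mem : ∀ i, insert i (pstar.erase (ζ i)) ∈ G.paths
  injOn : ∀ p ∈ G.paths, Set.InjOn ζ p
  image_eq : ∀ p ∈ G.paths, p.image ζ = pstar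

theorem isBestLinkMap_lineNetwork {E : Type*} [Fintype E] [DecidableEq E] {H : ℕ}
    {hop : E → Fin H} {θ : E → ℝ} (hθ : IsLinkParam θ) {pstar : Finset E}
    (hpstar : (lineNetwork hop).IsOptimalPath θ pstar) {ζ : E → E}
    (hζ : ∀ i, IsBestLinkOnHop hop θ i (ζ i)) :
    IsBestLinkMap (lineNetwork hop) θ pstar ζ := by
  obtain ⟨hinj, hsurj⟩ := mem_paths_lineNetwork.1 hpstar.1
  -- a link outside `pstar` is strictly worse than the link of `pstar` on its hop
  have hlt : ∀ i j, i ∉ pstar → j ∈ pstar → hop i = hop j → θ i < θ j := by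
    intro i j hi hj hij
    have h := hpstar.2 _ (exchange_mem_paths hpstar.1 hj hij)
      fun h => hi (h ▸ Finset.mem_insert_self _ _)
    have he := avgDelay_exchange θ hi hj
    exact (one_div_lt_one_div (hθ j).1 (hθ i).1).1 (by linarith)
  have hmem : ∀ i, ζ i ∈ pstar := by
    intro i
    obtain ⟨j, hj, hji⟩ := hsurj (hop i)
    by_contra h
    exact absurd ((hζ i).2 j hji) (not_le.2 (hlt _ _ h hj ((hζ i).1.trans hji.symm)))
  have hfix : ∀ i ∈ pstar, ζ i = i := fun i hi => hinj (hmem i) hi (hζ i).1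
  refine ⟨hmem, hfix, fun i hi => ?_, fun i => ?_, fun p hp a ha b hb hab => ?_, fun p hp => ?_⟩
  · exact hlt i (ζ i) (fun h => hi (hfix i h).symm) (hmem i) (hζ i).1.symm
  · exact exchange_mem_paths hpstar.1 (hmem i) (hζ i).1.symm
  · exact (mem_paths_lineNetwork.1 hp).1 ha hb (by rw [← (hζ a).1, hab, (hζ b).1])
  · ext j
    rw [Finset.mem_image]
    constructor
    · rintro ⟨i, -, rfl⟩
      exact hmem i
    · intro hj
      obtain ⟨i, hi, hij⟩ := (mem_paths_lineNetwork.1 hp).2 (hop j)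
      exact ⟨i, hi, hinj (hmem i) hj ((hζ i).1.trans hij)⟩

/-! ### The value of the program -/

section Program

variable {V E : Type*} [Fintype E] [DecidableEq E]

/-- Value of a program in which exploring the paths `detour i`, one for each link `i ∈ I`, suffices.
`K i` is the information needed to rule out that link `i` is as good as the best link. Every
confusing parameter is detected by some detour with information at least `K i` (`hup`). For each
link `i` there are confusing parameters that only the paths through `i` detect, with information at
most `K i + δ` (`hlow`). The weight `w p` scales both the information and the cost of `p`. -/
theorem lowerBoundProgram_eq_sum (G : RoutingNetwork V E) {pstar : Finset E} {I : Finset E}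
    {gap K : E → ℝ≥0∞} {detour : E → Finset E} {w : Finset E → ℝ≥0} {cost : Finset E → ℝ}
    {B : Set (E → ℝ)} {info : (E → ℝ) → Finset E → ℝ≥0∞} (hgap : ∀ i ∈ I, gap i ≠ 0)
    (hw : ∀ i ∈ I, w (detour i) ≠ 0) (hdetour : ∀ i ∈ I, detour i ∈ G.paths.erase pstar)
    (hfilter : ∀ i ∈ I, (I.filter fun j => j ∈ detour i) = {i})
    (hcost : ∀ p ∈ G.paths, ENNReal.ofReal (cost p) = w p * ∑ i ∈ I with i ∈ p, gap i)
    (hlow : ∀ i ∈ I, K i ≠ ∞ → ∀ δ : ℝ, 0 < δ → ∃ lam ∈ B, ∀ p ∈ G.paths.erase pstar,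
      info lam p ≤ if i ∈ p then w p * (K i + ENNReal.ofReal δ) else 0)
    (hup : ∀ lam ∈ B, ∃ i ∈ I, K i ≠ ∞ ∧ w (detour i) * K i ≤ info lam (detour i)) :
    G.lowerBoundProgram pstar cost B info = ∑ i ∈ I, gap i / K i := by
  unfold RoutingNetwork.lowerBoundProgram
  apply le_antisymm
  · -- a link with `K i = 0` contributes `gap i / 0 = ∞` to the sum
    by_cases hK : ∃ i ∈ I, K i = 0
    · obtain ⟨i, hi, hKi⟩ := hK
      have h : gap i / K i = ∞ := by rw [hKi]; exact ENNReal.div_zero (hgap i hi)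
      rw [ENNReal.sum_eq_top.2 ⟨i, hi, h⟩]
      exact le_top
    push Not at hK
    have hwK : ∀ i ∈ I, (w (detour i) : ℝ≥0∞) * K i ≠ 0 := fun i hi =>
      mul_ne_zero (by exact_mod_cast hw i hi) (hK i hi)
    set c : E → ℝ≥0 := fun i => ((w (detour i) * K i)⁻¹).toNNReal with hc
    have hc' : ∀ i ∈ I, (c i : ℝ≥0∞) = (w (detour i) * K i)⁻¹ := fun i hi =>
      ENNReal.coe_toNNReal (ENNReal.inv_ne_top.2 (hwK i hi))
    refine iInf₂_le_of_le (fun p => ∑ i ∈ I with detour i = p, c i) ?_ ?_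
    · refine le_iInf₂ fun lam hlam => ?_
      obtain ⟨i, hi, hKi, hinfo⟩ := hup lam hlam
      refine le_trans ?_ (Finset.single_le_sum
        (f := fun p => ((∑ i ∈ I with detour i = p, c i : ℝ≥0) : ℝ≥0∞) * info lam p)
        (fun _ _ => zero_le) (hdetour i hi))
      have h1 : c i ≤ ∑ j ∈ I with detour j = detour i, c j :=
        Finset.single_le_sum (f := c) (fun _ _ => zero_le) (by simp [hi])
      calc (1 : ℝ≥0∞) = (w (detour i) * K i)⁻¹ * (w (detour i) * K i) :=
            (ENNReal.inv_mul_cancel (hwK i hi) (ENNReal.mul_ne_top ENNReal.coe_ne_top hKi)).symm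
        _ ≤ _ := by
            rw [← hc' i hi]
            exact mul_le_mul' (by exact_mod_cast h1) hinfo
    · apply le_of_eq
      have h1 : ∀ p ∈ G.paths, ((∑ i ∈ I with detour i = p, c i : ℝ≥0) : ℝ≥0∞) *
          ENNReal.ofReal (cost p) = ∑ i ∈ I with detour i = p, gap i / K i := by
        intro p hp
        rw [ENNReal.ofNNReal_finsetSum, Finset.sum_mul]
        refine Finset.sum_congr rfl fun i hi => ?_
        obtain ⟨hiI, rfl⟩ := Finset.mem_filter.1 hi
        have hw0 : (w (detour i) : ℝ≥0∞) ≠ 0 := by exact_mod_cast hw i hiI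
        rw [hcost _ hp, hfilter i hiI, Finset.sum_singleton, hc' i hiI,
          ENNReal.mul_inv (.inl hw0) (.inl ENNReal.coe_ne_top), div_eq_mul_inv]
        calc _ = ((w (detour i) : ℝ≥0∞)⁻¹ * w (detour i)) * (gap i * (K i)⁻¹) := by ring
          _ = _ := by rw [ENNReal.inv_mul_cancel hw0 ENNReal.coe_ne_top, one_mul]
      rw [Finset.sum_congr rfl h1]
      exact Finset.sum_fiberwise_of_maps_to
        (fun i hi => Finset.mem_of_mem_erase (hdetour i hi)) _
  · refine le_iInf₂ fun x hx => ?_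
    have h1 : ∑ p ∈ G.paths, (x p : ℝ≥0∞) * ENNReal.ofReal (cost p) =
        ∑ i ∈ I, gap i * ((∑ p ∈ G.paths with i ∈ p, x p * w p : ℝ≥0) : ℝ≥0∞) := by
      calc _ = ∑ p ∈ G.paths, ∑ i ∈ I, if i ∈ p then gap i * ((x p * w p : ℝ≥0) : ℝ≥0∞) else 0 := by
            refine Finset.sum_congr rfl fun p hp => ?_
            rw [hcost p hp, ← Finset.sum_filter, ← mul_assoc, Finset.mul_sum]
            refine Finset.sum_congr rfl fun i _ => ?_
            rw [ENNReal.coe_mul, mul_comm]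
        _ = _ := by
            rw [Finset.sum_comm]
            refine Finset.sum_congr rfl fun i _ => ?_
            rw [← Finset.sum_filter, ENNReal.ofNNReal_finsetSum, Finset.mul_sum]
    rw [h1]
    refine Finset.sum_le_sum fun i hi => ?_
    rcases eq_or_ne (K i) ∞ with hKi | hKi
    · rw [hKi, ENNReal.div_top]
      exact zero_le
    set y : ℝ≥0 := ∑ p ∈ G.paths with i ∈ p, x p * w p with hy
    -- feasibility at the confusing parameters for link `i`
    have h2 : ∀ δ : ℝ, 0 < δ → 1 ≤ (y : ℝ≥0∞) * (K i + ENNReal.ofReal δ) := by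
      intro δ hδ
      obtain ⟨lam, hlam, hinfo⟩ := hlow i hi hKi δ hδ
      refine (hx.trans (iInf₂_le lam hlam)).trans ?_
      calc ∑ p ∈ G.paths.erase pstar, (x p : ℝ≥0∞) * info lam p
          ≤ ∑ p ∈ G.paths.erase pstar,
              (x p : ℝ≥0∞) * if i ∈ p then w p * (K i + ENNReal.ofReal δ) else 0 :=
            Finset.sum_le_sum fun p hp => mul_le_mul_right (hinfo p hp) _
        _ ≤ ∑ p ∈ G.paths, (x p : ℝ≥0∞) * if i ∈ p then w p * (K i + ENNReal.ofReal δ) else 0 :=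
            Finset.sum_le_sum_of_subset (Finset.erase_subset _ _)
        _ = _ := by
            rw [hy, ENNReal.ofNNReal_finsetSum, Finset.sum_mul, Finset.sum_filter]
            refine Finset.sum_congr rfl fun p _ => ?_
            split_ifs
            · rw [ENNReal.coe_mul, mul_assoc]
            · rw [mul_zero]
    have h3 : 1 ≤ (y : ℝ≥0∞) * K i := by
      refine ENNReal.le_of_forall_pos_le_add fun ε hε _ => ?_
      have hδ : (0 : ℝ) < ε / (y + 1) := by positivity
      refine (h2 _ hδ).trans ?_
      rw [mul_add]
      refine add_le_add_right ?_ _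
      rw [← ENNReal.ofReal_coe_nnreal, ← ENNReal.ofReal_coe_nnreal (p := ε),
        ← ENNReal.ofReal_mul y.coe_nonneg]
      refine ENNReal.ofReal_le_ofReal ?_
      rw [mul_div_assoc', div_le_iff₀ (by positivity)]
      nlinarith [y.coe_nonneg, ε.coe_nonneg]
    refine ENNReal.div_le_of_le_mul ?_
    rw [mul_assoc]
    exact le_mul_of_one_le_right zero_le h3

end Program

/-! ### The constants for semi-bandit feedback and hop-by-hop routing -/

theorem IsLinkParam.update {E : Type*} [DecidableEq E] {θ : E → ℝ} (hθ : IsLinkParam θ) {i : E}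
    {w : ℝ} (h0 : 0 < w) (h1 : w ≤ 1) : IsLinkParam (Function.update θ i w) := by
  intro j
  rcases eq_or_ne j i with rfl | h
  · simp [h0, h1]
  · simpa [h] using hθ j

namespace IsBestLinkMap

variable {V E : Type*} [Fintype E] [DecidableEq E] {G : RoutingNetwork V E} {θ : E → ℝ}
  {pstar : Finset E} {ζ : E → E}

theorem not_mem (h : IsBestLinkMap G θ pstar ζ) {i : E} (hi : i ≠ ζ i) : i ∉ pstar :=
  fun hm => hi (h.fixed i hm).symm

theorem filter_mem_detour (h : IsBestLinkMap G θ pstar ζ) {i : E} (hi : i ≠ ζ i) :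
    ((Finset.univ.filter fun j => j ≠ ζ j).filter fun j => j ∈ insert i (pstar.erase (ζ i))) =
      {i} := by
  ext j
  simp only [Finset.mem_filter, Finset.mem_univ, true_and, Finset.mem_insert, Finset.mem_erase,
    Finset.mem_singleton]
  constructor
  · rintro ⟨hj, rfl | ⟨-, hm⟩⟩
    · rfl
    · exact absurd hm (h.not_mem hj)
  · rintro rfl
    exact ⟨hi, .inl rfl⟩

theorem detour_mem_erase (h : IsBestLinkMap G θ pstar ζ) {i : E} (hi : i ≠ ζ i) :
    insert i (pstar.erase (ζ i)) ∈ G.paths.erase pstar :=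
  Finset.mem_erase.2 ⟨fun he => h.not_mem hi (he ▸ Finset.mem_insert_self _ _), h.detour_mem i⟩

theorem avgDelay_eq (h : IsBestLinkMap G θ pstar ζ) (lam : E → ℝ) {p : Finset E}
    (hp : p ∈ G.paths) : avgDelay lam pstar = ∑ i ∈ p, 1 / lam (ζ i) := by
  unfold avgDelay
  rw [← h.image_eq p hp, Finset.sum_image (h.injOn p hp)]

theorem image_erase (h : IsBestLinkMap G θ pstar ζ) {p : Finset E} (hp : p ∈ G.paths) {i : E}
    (hi : i ∈ p) : (p.erase i).image ζ = pstar.erase (ζ i) := by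
  have hinj := h.injOn p hp
  rw [← h.image_eq p hp]
  ext j
  simp only [Finset.mem_image, Finset.mem_erase]
  constructor
  · rintro ⟨a, ⟨hai, ha⟩, rfl⟩
    exact ⟨fun he => hai (hinj ha hi he), a, ha, rfl⟩
  · rintro ⟨hji, a, ha, rfl⟩
    exact ⟨a, ⟨fun he => hji (by rw [he]), ha⟩, rfl⟩

theorem one_div_sub_nonneg (h : IsBestLinkMap G θ pstar ζ) (hθ : IsLinkParam θ) (i : E) :
    0 ≤ 1 / θ i - 1 / θ (ζ i) := by
  rcases eq_or_ne i (ζ i) with he | hi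
  · rw [← he, sub_self]
  · exact sub_nonneg.2 (one_div_le_one_div_of_le (hθ i).1 (h.lt i hi).le)

theorem gap_ne_zero (h : IsBestLinkMap G θ pstar ζ) (hθ : IsLinkParam θ) {i : E} (hi : i ≠ ζ i) :
    ENNReal.ofReal (1 / θ i - 1 / θ (ζ i)) ≠ 0 :=
  (ENNReal.ofReal_pos.2 (sub_pos.2 (one_div_lt_one_div_of_lt (hθ i).1 (h.lt i hi)))).ne'

/-- The regret of a path is the sum of the regrets of its links. -/
theorem ofReal_avgDelay_sub (h : IsBestLinkMap G θ pstar ζ) (hθ : IsLinkParam θ) {p : Finset E}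
    (hp : p ∈ G.paths) :
    ENNReal.ofReal (avgDelay θ p - avgDelay θ pstar) =
      ∑ i ∈ Finset.univ.filter (fun i => i ≠ ζ i) with i ∈ p,
        ENNReal.ofReal (1 / θ i - 1 / θ (ζ i)) := by
  rw [h.avgDelay_eq θ hp, avgDelay, ← Finset.sum_sub_distrib,
    ENNReal.ofReal_sum_of_nonneg fun i _ => h.one_div_sub_nonneg hθ i]
  refine (Finset.sum_subset (fun i hi => (Finset.mem_filter.1 hi).2) fun i hip hi => ?_).symm
  have he : i = ζ i := by
    by_contra he
    exact hi (by simp [hip, he])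
  rw [← he, sub_self, ENNReal.ofReal_zero]

/-- If `pstar` is not optimal under `lam`, then some link is better than the link of `pstar` that it
may replace. -/
theorem exists_lt_of_avgDelay_lt (h : IsBestLinkMap G θ pstar ζ) {lam : E → ℝ}
    (hlam : IsLinkParam lam) (hex : ∃ p ∈ G.paths, avgDelay lam p < avgDelay lam pstar) :
    ∃ i, i ≠ ζ i ∧ lam (ζ i) < lam i := by
  obtain ⟨p, hp, hlt⟩ := hex
  rw [h.avgDelay_eq lam hp, avgDelay] at hlt
  obtain ⟨i, -, hi⟩ := Finset.exists_lt_of_sum_lt hlt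
  have hi' := (one_div_lt_one_div (hlam i).1 (hlam (ζ i)).1).1 hi
  exact ⟨i, fun he => hi'.ne (by rw [← he]), hi'⟩

/-- Making a link `i` outside `pstar` better than the best link on its hop gives a confusing
parameter. -/
theorem update_mem_badSemiBandit (h : IsBestLinkMap G θ pstar ζ) (hθ : IsLinkParam θ) {i : E}
    (hi : i ≠ ζ i) {w : ℝ} (hw : θ (ζ i) < w) (h1 : w ≤ 1) :
    Function.update θ i w ∈ G.badSemiBandit θ pstar := by
  refine ⟨hθ.update ((hθ _).1.trans hw) h1, fun j hj => ?_, _, h.detour_mem i, ?_⟩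
  · exact Function.update_of_ne (fun he => h.not_mem hi (by rwa [← he])) _ _
  · have he := avgDelay_exchange (Function.update θ i w) (h.not_mem hi) (h.mem i)
    rw [Function.update_self, Function.update_of_ne hi.symm] at he
    have := one_div_lt_one_div_of_lt (hθ (ζ i)).1 hw
    linarith

theorem badSemiBandit_subset_badBandit (G : RoutingNetwork V E) (θ : E → ℝ) (pstar : Finset E) :
    G.badSemiBandit θ pstar ⊆ G.badBandit θ pstar :=
  fun _ hlam => ⟨hlam.1, Multiset.map_congr rfl hlam.2.1, hlam.2.2⟩

/-- Value of the program when the information of a path is the weighted sum of the divergences of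
its links. -/
theorem lowerBoundProgram_semiBandit (h : IsBestLinkMap G θ pstar ζ) (hθ : IsLinkParam θ)
    {w : Finset E → ℝ≥0} (hw : ∀ p, p.Nonempty → w p ≠ 0) {cost : Finset E → ℝ} {c : ℝ≥0∞}
    (hc : pstar.Nonempty → c ≠ 0)
    (hcost : ∀ p ∈ G.paths, ENNReal.ofReal (cost p) =
      w p * (c * ENNReal.ofReal (avgDelay θ p - avgDelay θ pstar)))
    {info : (E → ℝ) → Finset E → ℝ≥0∞}
    (hinfo : ∀ lam, IsLinkParam lam → ∀ p, info lam p = w p * infoSemiBandit θ lam p) :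
    G.lowerBoundProgram pstar cost (G.badSemiBandit θ pstar) info =
      ∑ i with i ≠ ζ i, c * ENNReal.ofReal (1 / θ i - 1 / θ (ζ i)) / KLG (θ i) (θ (ζ i)) := by
  refine lowerBoundProgram_eq_sum G (detour := fun i => insert i (pstar.erase (ζ i))) (w := w)
    (fun i hi => mul_ne_zero (hc ⟨_, h.mem i⟩) (h.gap_ne_zero hθ (Finset.mem_filter.1 hi).2))
    (fun i _ => hw _ (Finset.insert_nonempty _ _))
    (fun i hi => h.detour_mem_erase (Finset.mem_filter.1 hi).2)
    (fun i hi => h.filter_mem_detour (Finset.mem_filter.1 hi).2)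
    (fun p hp => by rw [hcost p hp, h.ofReal_avgDelay_sub hθ hp, Finset.mul_sum _ _ c]) ?_ ?_
  · intro i hi hK δ hδ
    replace hi := (Finset.mem_filter.1 hi).2
    have hθi := hθ i
    have hv1 : θ (ζ i) < 1 := (hθ (ζ i)).2.lt_of_ne fun h1 =>
      hK (by rw [h1]; exact KLG_one_right hθi.1 (h1 ▸ h.lt i hi))
    obtain ⟨v, hv, hv1, hle⟩ := exists_klMass_mul_geoSeries_le (isLaw_geoSeries hθi.1 hθi.2)
      (summable_mean_geoSeries hθi.1 hθi.2) .one (hθ (ζ i)).1 hv1 hδ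
    simp only [mul_one, ← KLG_eq_klMass_coeff] at hle
    have hmem := h.update_mem_badSemiBandit hθ hi hv hv1
    refine ⟨_, hmem, fun p _ => ?_⟩
    rw [hinfo _ hmem.1]
    have hz : ∀ j, j ≠ i → KLG (θ j) (Function.update θ i v j) = 0 := fun j hj => by
      rw [Function.update_of_ne hj]
      exact klMass_self _
    split_ifs with hip
    · rw [infoSemiBandit, Finset.sum_eq_single_of_mem i hip fun j _ hj => hz j hj,
        Function.update_self]
      exact mul_le_mul_right hle _
    · rw [infoSemiBandit, Finset.sum_eq_zero fun j hj => hz j fun he => hip (he ▸ hj), mul_zero]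
  · intro lam hlam
    obtain ⟨i, hi, hlt⟩ := h.exists_lt_of_avgDelay_lt hlam.1 hlam.2.2
    rw [hlam.2.1 _ (h.mem i)] at hlt
    have hli := (hlam.1 i).2
    refine ⟨i, by simp [hi],
      KLG_ne_top (hθ i).1 (hθ i).2 (hθ (ζ i)).1 (hlt.trans_le hli), ?_⟩
    rw [hinfo lam hlam.1]
    refine mul_le_mul_right ((KLG_mono (hθ i).1 (h.lt i hi).le hlt.le hli).trans ?_) _
    exact Finset.single_le_sum (f := fun j => KLG (θ j) (lam j)) (fun _ _ => zero_le)
      (Finset.mem_insert_self i _)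

theorem C2_eq (h : IsBestLinkMap G θ pstar ζ) (hθ : IsLinkParam θ) :
    G.C2 θ pstar =
      ∑ i with i ≠ ζ i, ENNReal.ofReal (1 / θ i - 1 / θ (ζ i)) / KLG (θ i) (θ (ζ i)) := by
  have := h.lowerBoundProgram_semiBandit hθ (w := fun _ => 1) (c := 1) (by simp) (by simp)
    (cost := fun p => avgDelay θ p - avgDelay θ pstar) (by simp)
    (info := infoSemiBandit θ) (by simp)
  simpa only [one_mul, RoutingNetwork.C2] using this

theorem avgDelay_pos {E : Type*} {θ : E → ℝ} (hθ : IsLinkParam θ) {p : Finset E}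
    (hp : p.Nonempty) : 0 < avgDelay θ p :=
  Finset.sum_pos (fun i _ => one_div_pos.2 (hθ i).1) hp

theorem infoHopByHop_eq {E : Type*} {θ lam : E → ℝ} (hθ : IsLinkParam θ) (hlam : IsLinkParam lam)
    (p : Finset E) :
    infoHopByHop θ lam p = ENNReal.ofReal (1 / avgDelay θ p) * infoSemiBandit θ lam p := by
  have h0 : 0 ≤ 1 / avgDelay θ p :=
    one_div_nonneg.2 (Finset.sum_nonneg fun i _ => (one_div_pos.2 (hθ i).1).le)
  rw [infoHopByHop, infoSemiBandit, Finset.mul_sum]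
  refine Finset.sum_congr rfl fun i _ => ?_
  rw [KLG_eq_mul_KLBer (hθ i).1 (hθ i).2 (hlam i).1 (hlam i).2, ← mul_assoc,
    ← ENNReal.ofReal_mul h0, one_div_mul_eq_div]
  rfl

theorem C3_eq (h : IsBestLinkMap G θ pstar ζ) (hθ : IsLinkParam θ) :
    G.C3 θ pstar =
      ∑ i with i ≠ ζ i, ENNReal.ofReal (1 / θ i - 1 / θ (ζ i)) / KLG (θ i) (θ (ζ i)) := by
  have hpos : ∀ p : Finset E, p.Nonempty → 0 < throughput θ p := fun p hp =>
    one_div_pos.2 (avgDelay_pos hθ hp)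
  have key := h.lowerBoundProgram_semiBandit hθ (w := fun p => (throughput θ p).toNNReal)
    (c := ENNReal.ofReal (throughput θ pstar)) (fun p hp => by simpa using hpos p hp)
    (fun hp => by simpa using hpos _ hp)
    (cost := fun p => throughput θ pstar - throughput θ p) (fun p hp => ?_)
    (info := infoHopByHop θ) (fun lam hlam p => infoHopByHop_eq hθ hlam p)
  · rw [RoutingNetwork.C3, RoutingNetwork.C3Throughput, key, ENNReal.div_eq_inv_mul,
      Finset.mul_sum]
    refine Finset.sum_congr rfl fun i _ => ?_
    have h0 := ENNReal.ofReal_pos.2 (hpos pstar ⟨_, h.mem i⟩)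
    rw [mul_div_assoc, ← mul_assoc, ENNReal.inv_mul_cancel h0.ne' ENNReal.ofReal_ne_top, one_mul]
  · -- the empty path occurs only for `H = 0`, where its average delay and its throughput are `0`
    rcases p.eq_empty_or_nonempty with rfl | hne
    · have : pstar = ∅ := by rw [← h.image_eq _ hp, Finset.image_empty]
      simp [this, throughput]
    · have hs : pstar.Nonempty := by rw [← h.image_eq p hp]; exact hne.image ζ
      have h1 := avgDelay_pos hθ hne
      have h2 := avgDelay_pos hθ hs
      change _ = ENNReal.ofReal (throughput θ p) * _
      rw [← ENNReal.ofReal_mul (hpos _ hs).le, ← ENNReal.ofReal_mul (hpos _ hne).le]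
      congr 1
      unfold throughput
      field_simp

end IsBestLinkMap

/-! ### The constant for bandit feedback -/

section Bandit

open PowerSeries

namespace IsBestLinkMap

variable {V E : Type*} [Fintype E] [DecidableEq E] {G : RoutingNetwork V E} {θ : E → ℝ}
  {pstar : Finset E} {ζ : E → E}

theorem prod_detour (h : IsBestLinkMap G θ pstar ζ) (f : E → PowerSeries ℝ) {i : E}
    (hi : i ≠ ζ i) :
    ∏ j ∈ insert i (pstar.erase (ζ i)), f j = f i * ∏ j ∈ pstar.erase (ζ i), f j :=
  Finset.prod_insert fun hm => h.not_mem hi (Finset.mem_of_mem_erase hm)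

/-- The remaining links of a path through `i` are slower than those of the detour through `i`. -/
theorem exists_prod_erase_eq (h : IsBestLinkMap G θ pstar ζ) (hθ : IsLinkParam θ) {p : Finset E}
    (hp : p ∈ G.paths) {i : E} (hi : i ∈ p) :
    ∃ S, IsLaw S ∧ ∏ j ∈ p.erase i, geoSeries (θ j) =
      (∏ j ∈ pstar.erase (ζ i), geoSeries (θ j)) * S := by
  have hle : ∀ j, θ j ≤ θ (ζ j) := fun j => by
    rcases eq_or_ne j (ζ j) with he | hj
    · rw [← he]
    · exact (h.lt j hj).le
  refine ⟨∏ j ∈ p.erase i, extraDelaySeries (θ j) (θ (ζ j)),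
    .prod fun j _ => isLaw_extraDelaySeries (hθ j).1 (hle j) (hθ _).2, ?_⟩
  rw [← h.image_erase hp hi, Finset.prod_image ((h.injOn p hp).mono (by simp)),
    ← Finset.prod_mul_distrib]
  exact Finset.prod_congr rfl fun j _ => (geoSeries_mul_extraDelaySeries (hθ _).1.ne').symm

theorem C1_eq (h : IsBestLinkMap G θ pstar ζ) (hθ : IsLinkParam θ)
    (hlt1 : ∀ i, i ≠ ζ i → θ (ζ i) < 1) :
    G.C1 θ pstar = ∑ i with i ≠ ζ i, ENNReal.ofReal (1 / θ i - 1 / θ (ζ i)) /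
      klMass (pathDelayMass θ (insert i (pstar.erase (ζ i)))) (pathDelayMass θ pstar) := by
  refine lowerBoundProgram_eq_sum G (detour := fun i => insert i (pstar.erase (ζ i)))
    (w := fun _ => 1) (fun i hi => h.gap_ne_zero hθ (Finset.mem_filter.1 hi).2)
    (fun i _ => one_ne_zero)
    (fun i hi => h.detour_mem_erase (Finset.mem_filter.1 hi).2)
    (fun i hi => h.filter_mem_detour (Finset.mem_filter.1 hi).2)
    (fun p hp => by rw [h.ofReal_avgDelay_sub hθ hp, ENNReal.coe_one, one_mul]) ?_ ?_
  · intro i hi _ δ hδ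
    replace hi := (Finset.mem_filter.1 hi).2
    have hR := isLaw_prod_geoSeries hθ (pstar.erase (ζ i))
    have hθi := hθ i
    have hF := (isLaw_geoSeries hθi.1 hθi.2).mul hR
    obtain ⟨v, hv, hv1, hle⟩ := exists_klMass_mul_geoSeries_le hF
      ((isLaw_geoSeries hθi.1 hθi.2).summable_mean_mul hR
        (summable_mean_geoSeries hθi.1 hθi.2) (summable_mean_prod_geoSeries hθ _))
      hR (hθ (ζ i)).1 (hlt1 i hi) hδ
    have hmem := h.update_mem_badSemiBandit hθ hi hv hv1
    refine ⟨_, badSemiBandit_subset_badBandit G θ pstar hmem, fun p hp => ?_⟩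
    rw [infoBandit, ENNReal.coe_one, one_mul]
    split_ifs with hip
    · obtain ⟨S, hS, hprod⟩ := h.exists_prod_erase_eq hθ (Finset.mem_of_mem_erase hp) hip
      have hrest : ∏ j ∈ p.erase i, geoSeries (Function.update θ i v j) =
          ∏ j ∈ p.erase i, geoSeries (θ j) := Finset.prod_congr rfl fun j hj => by
        rw [Function.update_of_ne (Finset.ne_of_mem_erase hj)]
      simp only [pathDelayMass_eq_coeff]
      rw [h.prod_detour _ hi, ← Finset.mul_prod_erase pstar _ (h.mem i),
        ← Finset.mul_prod_erase p _ hip, ← Finset.mul_prod_erase p _ hip, hrest, hprod,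
        Function.update_self, ← mul_assoc, ← mul_assoc]
      exact (hF.klMass_mul_le ((isLaw_geoSeries ((hθ _).1.trans hv) hv1).mul hR) hS).trans hle
    · have he : pathDelayMass (Function.update θ i v) p = pathDelayMass θ p := by
        simp only [pathDelayMass_eq_coeff]
        refine funext fun k => congrArg _ (Finset.prod_congr rfl fun j hj => ?_)
        rw [Function.update_of_ne fun he => hip (by rwa [← he])]
      rw [he, klMass_self]
  · intro lam ⟨hlam, hperm, hex⟩
    obtain ⟨i, hi, hlt⟩ := h.exists_lt_of_avgDelay_lt hlam hex
    have hθi := hθ i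
    -- the laws of the delay along `pstar` agree, since the parameters are permuted
    have hstar : ∏ j ∈ pstar, geoSeries (θ j) = ∏ j ∈ pstar, geoSeries (lam j) := by
      have := congrArg (fun s => (s.map geoSeries).prod) hperm
      simpa only [Multiset.map_map, Function.comp_def, Finset.prod_map_val] using this.symm
    have hdetour : ∏ j ∈ insert i (pstar.erase (ζ i)), geoSeries (θ j) =
        (∏ j ∈ pstar, geoSeries (θ j)) * extraDelaySeries (θ i) (θ (ζ i)) := by
      rw [h.prod_detour _ hi, ← geoSeries_mul_extraDelaySeries (hθ (ζ i)).1.ne',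
        ← Finset.mul_prod_erase pstar _ (h.mem i)]
      ring
    have hx := isLaw_extraDelaySeries hθi.1 (h.lt i hi).le (hθ (ζ i)).2
    refine ⟨i, by simp [hi], ?_, ?_⟩
    · refine ne_top_of_le_ne_top
        (KLG_ne_top hθi.1 hθi.2 (hθ (ζ i)).1 (hlt1 i hi)) ?_
      simp only [pathDelayMass_eq_coeff, KLG_eq_klMass_coeff]
      rw [h.prod_detour _ hi, ← Finset.mul_prod_erase pstar _ (h.mem i)]
      exact (isLaw_geoSeries hθi.1 hθi.2).klMass_mul_le
        (isLaw_geoSeries (hθ (ζ i)).1 (hθ (ζ i)).2) (isLaw_prod_geoSeries hθ _)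
    · rw [infoBandit, ENNReal.coe_one, one_mul]
      simp only [pathDelayMass_eq_coeff]
      rw [hdetour, hstar, h.prod_detour _ hi, ← Finset.mul_prod_erase pstar _ (h.mem i)]
      exact klMass_mul_geoSeries_mono (isLaw_prod_geoSeries hlam _)
        (isLogConcave_prod_geoSeries hlam _) hx (hlam _).1 hlt.le (hlam i).2

end IsBestLinkMap

end Bandit

theorem proposition1 {E : Type*} [Fintype E] [DecidableEq E] {H : ℕ} (hop : E → Fin H)
    (θ : E → ℝ) (hθ : IsLinkParam θ)
    (pstar : Finset E) (hpstar : (lineNetwork hop).IsOptimalPath θ pstar)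
    (ζ : E → E) (hζ : ∀ i, IsBestLinkOnHop hop θ i (ζ i)) :
    ((lineNetwork hop).C2 θ pstar = (lineNetwork hop).C3 θ pstar ∧
      (lineNetwork hop).C3 θ pstar =
        ∑ i with i ≠ ζ i,
          ENNReal.ofReal (1 / θ i - 1 / θ (ζ i)) / KLG (θ i) (θ (ζ i))) ∧
    ((∀ i, i ≠ ζ i → θ (ζ i) < 1) →
      (lineNetwork hop).C1 θ pstar =
        ∑ i with i ≠ ζ i,
          ENNReal.ofReal (1 / θ i - 1 / θ (ζ i)) /
            klMass (pathDelayMass θ (insert i (pstar.erase (ζ i)))) (pathDelayMass θ pstar)) := by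
  have h := isBestLinkMap_lineNetwork hθ hpstar hζ
  exact ⟨⟨(h.C2_eq hθ).trans (h.C3_eq hθ).symm, h.C3_eq hθ⟩, h.C1_eq hθ⟩
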